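/- Let $p_t(u)=\frac{1}{\sqrt{2\pi t}}e^{-u^2/(2t)}$ for $t>0$, $u\in\mathbb R$. Let $W$ be a space-time white noise on $\mathbb R\times[0,\infty)$, i.e. a centered Gaussian family $W(A)$, indexed by the Borel sets $A\subset\mathbb R\times[0,\infty)$ of finite Lebesgue measure, with $E\,W(A)W(B)=|A\cap B|$. Let $$x(u)=\int_0^1\int_{\mathbb R}p_{1-s}(u-v)\,W(dv,ds),\qquad u\in\mathbb R,$$ be the solution at time $t=1$ of the heat equation $\partial_t x=\frac12\partial_u^2x+W$, $x(\cdot,0)=0$, where the stochastic integral of a deterministic square integrable function is defined by the $L_2$-isometry, and a modification of $x$ is taken that is jointly measurable in $(u,\omega)$ on $[U_1,U_2]\times\Omega$ (up to null sets). Let $U_1<U_2$ be arbitrary real numbers and $x_{U_1}(u)=x(u)-x(U_1)$, $u\in[U_1,U_2]$. Then for every $z\in\mathbb R$ there is a random variable $l(z)$ such that, for every integer $p\ge1$, $$\int_{U_1}^{U_2}p_\varepsilon(x_{U_1}(u)-z)\,du\in L_p\ \ (\varepsilon>0),\qquad l(z)\in L_p,\qquad \int_{U_1}^{U_2}p_\varepsilon(x_{U_1}(u)-z)\,du\longrightarrow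 l(z)\ \text{ in } L_p\ \text{ as }\varepsilon\to0+ .$$ That is, the process $x_{U_1}$ has a local time on $[U_1,U_2]$, with respect to the spatial variable, at every point $z$. -/

import Mathlib

open MeasureTheory ProbabilityTheory Filter Topology
open scoped ENNReal

noncomputable section

namespace HeatLocalTime

/-- The Gaussian (heat) kernel `p_t(u) = (2 π t)^{-1/2} exp (-u² / (2 t))`, used for `t > 0`. -/
def heatKernel (t u : ℝ) : ℝ :=
  1 / Real.sqrt (2 * Real.pi * t) * Real.exp (-u ^ 2 / (2 * t))

/-- `W` is a Gaussian white noise with control measure `μ`: a centered Gaussian random measure,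
that is, a centered Gaussian family indexed by the measurable sets of finite measure `μ`, with
covariance `E W(A) W(B) = μ (A ∩ B)`. In particular its values on disjoint sets are independent.
The values of `W` on other sets are irrelevant. -/
structure IsWhiteNoise {E Ω : Type*} [MeasurableSpace E] [MeasurableSpace Ω]
    (μ : Measure E) (P : Measure Ω) (W : Set E → Ω → ℝ) : Prop where
  gaussian : IsGaussianProcess
    (fun A : {A : Set E // MeasurableSet A ∧ μ A < ∞} => W A.1) P
  centered : ∀ A : Set E, MeasurableSet A → μ A < ∞ → ∫ ω, W A ω ∂P = 0
  covariance : ∀ A B : Set E, MeasurableSet A → μ A < ∞ → MeasurableSet B → μ B < ∞ →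
    ∫ ω, W A ω * W B ω ∂P = μ.real (A ∩ B)

/-- The stochastic integral `∑_c c W({g = c})` of a simple function `g`. -/
def simpleIntegral {E Ω : Type*} [MeasurableSpace E] (W : Set E → Ω → ℝ)
    (g : SimpleFunc E ℝ) (ω : Ω) : ℝ :=
  ∑ c ∈ g.range, c * W (g ⁻¹' {c}) ω

/-- `X` is (a version of) the stochastic integral `∫ f dW` of the deterministic function `f`:
the extension by the Itô isometry of the integral from square integrable simple functions to
`L₂(μ)`. So `X` is the limit in `L₂(P)` of the integrals of simple functions which
converge to `f` in `L₂(μ)`. -/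
def IsStochasticIntegral {E Ω : Type*} [MeasurableSpace E] [MeasurableSpace Ω]
    (μ : Measure E) (P : Measure Ω) (W : Set E → Ω → ℝ) (f : E → ℝ) (X : Ω → ℝ) : Prop :=
  MemLp f 2 μ ∧ MemLp X 2 P ∧
    ∃ g : ℕ → SimpleFunc E ℝ, (∀ n, MemLp (g n) 2 μ) ∧
      Tendsto (fun n => eLpNorm (fun e => g n e - f e) 2 μ) atTop (𝓝 0) ∧
      Tendsto (fun n => eLpNorm (fun ω => simpleIntegral W (g n) ω - X ω) 2 P) atTop (𝓝 0)

/-- Lebesgue measure on `ℝ × [0, ∞)`; the first coordinate is space, the second one is time. -/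
def spaceTimeMeasure : Measure (ℝ × ℝ) :=
  volume.restrict (Set.univ ×ˢ Set.Ici 0)

/-- The integrand `(v, s) ↦ p_{t-s}(u - v) 1_{[0, t)}(s)`. -/
def heatIntegrand (t u : ℝ) (q : ℝ × ℝ) : ℝ :=
  (Set.univ ×ˢ Set.Ico 0 t).indicator (fun r : ℝ × ℝ => heatKernel (t - r.2) (u - r.1)) q

/-- `x` is (a modification of) the solution at time `t`, as a random function of the space
variable `u`, of `∂ₜ x = ½ ∂²ᵤ x + W`, `x(·, 0) = 0`, namely
`x(u, t) = ∫_0^t ∫_ℝ p_{t-s}(u - v) W(dv, ds)` almost surely, for each `u`. -/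
def IsHeatSolutionAt {Ω : Type*} [MeasurableSpace Ω] (P : Measure Ω)
    (W : Set (ℝ × ℝ) → Ω → ℝ) (t : ℝ) (x : ℝ → Ω → ℝ) : Prop :=
  ∀ u : ℝ, IsStochasticIntegral spaceTimeMeasure P W (heatIntegrand t u) (x u)

/-- `∫_{T₁}^{T₂} p_ε(y(u) - z) du`. -/
def localTimeApprox {Ω : Type*} (y : ℝ → Ω → ℝ) (T₁ T₂ z ε : ℝ) (ω : Ω) : ℝ :=
  ∫ u in T₁..T₂, heatKernel ε (y u ω - z)

/-- `l` is the local time at the point `z` of the random function `y` on `[T₁, T₂]`: for every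
natural `p ≥ 1`, the integrals `∫_{T₁}^{T₂} p_ε(y(u) - z) du` belong to `L_p` and converge to
`l` in `L_p` as `ε → 0+`. -/
def IsLocalTime {Ω : Type*} [MeasurableSpace Ω] (P : Measure Ω)
    (y : ℝ → Ω → ℝ) (T₁ T₂ z : ℝ) (l : Ω → ℝ) : Prop :=
  ∀ p : ℕ, 1 ≤ p →
    (∀ ε : ℝ, 0 < ε → MemLp (localTimeApprox y T₁ T₂ z ε) (p : ℝ≥0∞) P) ∧
    MemLp l (p : ℝ≥0∞) P ∧
    Tendsto (fun ε : ℝ => eLpNorm (fun ω => localTimeApprox y T₁ T₂ z ε ω - l ω) (p : ℝ≥0∞) P)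
      (𝓝[>] 0) (𝓝 0)

end HeatLocalTime

end

/-! The process `x` is centered Gaussian with covariance `Q(u - w) - |u - w| / 2`, where `Q` is even
with `Q'' = p_2` (`integral_heatIntegrand_mul`). Increments from `U₁` therefore have the Brownian
covariance `min v w - U₁` minus the double integral of `p_2(s - t)` over `[0, v - U₁] × [0, w -
U₁]`. Convolution with `p_2` on an interval of length `L` has norm at most `2 * heatCDF L < 1`
(Schur test), so the variance of any linear combination of increments is at least a fixed positive
multiple of the Brownian one, for every interval length (`le_integral_sq_sum_heatIntegrand`).

By Fourier inversion, an even moment of the difference of two approximations is an integral, over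
times and frequencies, of characteristic functions of increments against products of `exp(-ε c²/2) -
exp(-δ c²/2)` (`eLpNorm_localTimeApprox_sub_pow_le`). The characteristic functions are dominated by
those of a scaled Brownian motion, whose total integral is finite
(`exists_lintegral_exp_neg_minForm_le`). Dominated convergence then shows that the approximations
are Cauchy in every even `L_p`, hence in every `L_p`, and completeness gives the limit. The level
`z` enters only through phases of modulus one. -/

noncomputable section

namespace HeatLocalTime

/-! ### Stochastic integrals and their characteristic functions. -/

section WhiteNoise

variable {E Ω : Type*} [MeasurableSpace E] [MeasurableSpace Ω] {μ : Measure E} {P : Measure Ω}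
  {W : Set E → Ω → ℝ}

lemma measure_preimage_singleton_lt_top {g : SimpleFunc E ℝ} (hg : MemLp g 2 μ) {c : ℝ}
    (hc : c ≠ 0) : μ (g ⁻¹' {c}) < ∞ :=
  SimpleFunc.measure_preimage_lt_top_of_memLp (by norm_num) (by norm_num) g hg c hc

lemma IsWhiteNoise.memLp (hW : IsWhiteNoise μ P W) {A : Set E} (hA : MeasurableSet A)
    (hA' : μ A < ∞) : MemLp (W A) 2 P :=
  (hW.gaussian.hasGaussianLaw_eval ⟨A, hA, hA'⟩).memLp_two

lemma IsWhiteNoise.memLp_simpleIntegral (hW : IsWhiteNoise μ P W) {g : SimpleFunc E ℝ}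
    (hg : MemLp g 2 μ) : MemLp (simpleIntegral W g) 2 P := by
  unfold simpleIntegral
  refine memLp_finsetSum _ fun c _ => ?_
  -- The fibre over `0` may have infinite measure, where nothing is known about `W`; its coefficient
  -- vanishes. The same case split recurs below.
  by_cases hc : c = 0
  · simp [hc]
  · exact (hW.memLp (g.measurableSet_fiber c) (measure_preimage_singleton_lt_top hg hc)).const_mul c

lemma IsWhiteNoise.integral_simpleIntegral (hW : IsWhiteNoise μ P W) {g : SimpleFunc E ℝ}
    (hg : MemLp g 2 μ) : ∫ ω, simpleIntegral W g ω ∂P = 0 := by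
  have := hW.gaussian.isProbabilityMeasure
  unfold simpleIntegral
  rw [integral_finsetSum]
  · refine Finset.sum_eq_zero fun c _ => ?_
    by_cases hc : c = 0
    · simp [hc]
    · rw [integral_const_mul, hW.centered _ (g.measurableSet_fiber c)
        (measure_preimage_singleton_lt_top hg hc), mul_zero]
  · intro c _
    by_cases hc : c = 0
    · simp [hc]
    · exact ((hW.memLp (g.measurableSet_fiber c)
        (measure_preimage_singleton_lt_top hg hc)).integrable (by norm_num)).const_mul c

lemma simpleFunc_eq_sum_indicator (g : SimpleFunc E ℝ) (e : E) :
    g e = ∑ c ∈ g.range, c * (g ⁻¹' {c}).indicator 1 e := by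
  rw [Finset.sum_eq_single (g e)]
  · simp
  · intro c _ hc
    have : e ∉ g ⁻¹' {c} := fun h => hc h.symm
    simp [this]
  · intro h
    exact absurd (g.mem_range_self e) h

/-- The Itô isometry for simple functions, in polarized form. -/
lemma IsWhiteNoise.integral_simpleIntegral_mul (hW : IsWhiteNoise μ P W) {g h : SimpleFunc E ℝ}
    (hg : MemLp g 2 μ) (hh : MemLp h 2 μ) :
    ∫ ω, simpleIntegral W g ω * simpleIntegral W h ω ∂P = ∫ e, g e * h e ∂μ := by
  have hL : ∀ ω, simpleIntegral W g ω * simpleIntegral W h ω =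
      ∑ c ∈ g.range, ∑ d ∈ h.range, (c * d) * (W (g ⁻¹' {c}) ω * W (h ⁻¹' {d}) ω) := by
    intro ω
    simp only [simpleIntegral, Finset.sum_mul_sum]
    exact Finset.sum_congr rfl fun c _ => Finset.sum_congr rfl fun d _ => by ring
  have hR : ∀ e, g e * h e =
      ∑ c ∈ g.range, ∑ d ∈ h.range,
        (c * d) * ((g ⁻¹' {c} ∩ h ⁻¹' {d}).indicator 1 e : ℝ) := by
    intro e
    rw [simpleFunc_eq_sum_indicator g e, simpleFunc_eq_sum_indicator h e, Finset.sum_mul_sum]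
    refine Finset.sum_congr rfl fun c _ => Finset.sum_congr rfl fun d _ => ?_
    rw [Set.inter_indicator_one]
    simp only [Pi.mul_apply]
    ring
  have hint : ∀ c d : ℝ, Integrable
      (fun ω => (c * d) * (W (g ⁻¹' {c}) ω * W (h ⁻¹' {d}) ω)) P := by
    intro c d
    by_cases hc : c = 0
    · simp [hc]
    by_cases hd : d = 0
    · simp [hd]
    exact ((hW.memLp (g.measurableSet_fiber c)
      (measure_preimage_singleton_lt_top hg hc)).integrable_mul (hW.memLp (h.measurableSet_fiber d)
      (measure_preimage_singleton_lt_top hh hd))).const_mul _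
  have hint' : ∀ c d : ℝ, Integrable
      (fun e => (c * d) * ((g ⁻¹' {c} ∩ h ⁻¹' {d}).indicator 1 e : ℝ)) μ := by
    intro c d
    by_cases hc : c = 0
    · simp [hc]
    refine Integrable.const_mul ?_ _
    refine (integrable_indicator_iff ((g.measurableSet_fiber c).inter
      (h.measurableSet_fiber d))).2 ?_
    exact integrableOn_const (hs := ((measure_mono Set.inter_subset_left).trans_lt
      (measure_preimage_singleton_lt_top hg hc)).ne)
  simp_rw [hL, hR]
  rw [integral_finsetSum _ fun c _ => integrable_finsetSum _ fun d _ => hint c d,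
    integral_finsetSum _ fun c _ => integrable_finsetSum _ fun d _ => hint' c d]
  refine Finset.sum_congr rfl fun c _ => ?_
  rw [integral_finsetSum _ fun d _ => hint c d, integral_finsetSum _ fun d _ => hint' c d]
  refine Finset.sum_congr rfl fun d _ => ?_
  by_cases hc : c = 0
  · simp [hc]
  by_cases hd : d = 0
  · simp [hd]
  rw [integral_const_mul, integral_const_mul, hW.covariance _ _ (g.measurableSet_fiber c)
      (measure_preimage_singleton_lt_top hg hc) (h.measurableSet_fiber d)
      (measure_preimage_singleton_lt_top hh hd),
    integral_indicator_one ((g.measurableSet_fiber c).inter (h.measurableSet_fiber d))]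

/-- The combination is a finite linear combination of values of `W`, indexed by pairs (function,
value), and these are jointly Gaussian. -/
lemma IsWhiteNoise.hasGaussianLaw_sum_simpleIntegral (hW : IsWhiteNoise μ P W)
    {ι : Type*} [Fintype ι] {g : ι → SimpleFunc E ℝ} (hg : ∀ i, MemLp (g i) 2 μ) (a : ι → ℝ) :
    HasGaussianLaw (fun ω => ∑ i, a i * simpleIntegral W (g i) ω) P := by
  classical
  -- The empty set replaces the zero fibre, which need not have finite measure; the coefficient `a
  -- q.1 * q.2` is then `0`.
  let A : (Σ _ : ι, ℝ) → {A : Set E // MeasurableSet A ∧ μ A < ∞} := fun q =>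
    if hq : q.2 = 0 then ⟨∅, MeasurableSet.empty, by simp⟩
    else ⟨g q.1 ⁻¹' {q.2}, (g q.1).measurableSet_fiber q.2,
      measure_preimage_singleton_lt_top (hg q.1) hq⟩
  have h := ((hW.gaussian.comp_right A).smul (fun q => a q.1 * q.2)).hasGaussianLaw_fun_sum
    (I := Finset.univ.sigma fun i => (g i).range)
  refine h.congr (ae_of_all _ fun ω => ?_)
  dsimp only
  rw [Finset.sum_sigma]
  refine Finset.sum_congr rfl fun i _ => ?_
  rw [simpleIntegral, Finset.mul_sum]
  refine Finset.sum_congr rfl fun c _ => ?_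
  by_cases hc : c = 0
  · simp [hc]
  · simp [A, hc, mul_assoc]

lemma integral_cexp_of_hasGaussianLaw {Y : Ω → ℝ} (hY : HasGaussianLaw Y P)
    (h0 : ∫ ω, Y ω ∂P = 0) :
    ∫ ω, Complex.exp (Y ω * Complex.I) ∂P = Complex.exp (-((∫ ω, Y ω ^ 2 ∂P : ℝ) : ℂ) / 2) := by
  have h1 : charFun (P.map Y) 1 = ∫ ω, Complex.exp (Y ω * Complex.I) ∂P := by
    rw [charFun_apply_real, integral_map hY.aemeasurable (by fun_prop)]
    simp
  rw [← h1, hY.map_eq_gaussianReal, charFun_gaussianReal, h0,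
    variance_of_integral_eq_zero hY.aemeasurable h0]
  have : (0 : ℝ) ≤ ∫ ω, Y ω ^ 2 ∂P := integral_nonneg fun _ => sq_nonneg _
  simp [Real.coe_toNNReal _ this, neg_div]

lemma IsWhiteNoise.integral_cexp_sum_simpleIntegral (hW : IsWhiteNoise μ P W)
    {ι : Type*} [Fintype ι] {g : ι → SimpleFunc E ℝ} (hg : ∀ i, MemLp (g i) 2 μ) (a : ι → ℝ) :
    ∫ ω, Complex.exp ((∑ i, a i * simpleIntegral W (g i) ω : ℝ) * Complex.I) ∂P =
      Complex.exp (-((∫ e, (∑ i, a i * g i e) ^ 2 ∂μ : ℝ) : ℂ) / 2) := by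
  have := hW.gaussian.isProbabilityMeasure
  rw [integral_cexp_of_hasGaussianLaw (hW.hasGaussianLaw_sum_simpleIntegral hg a)]
  · congr 4
    simp_rw [sq, Finset.sum_mul_sum]
    have e1 : ∀ i j, Integrable (fun ω => a i * simpleIntegral W (g i) ω *
        (a j * simpleIntegral W (g j) ω)) P := fun i j =>
      ((hW.memLp_simpleIntegral (hg i)).const_mul (a i)).integrable_mul
        ((hW.memLp_simpleIntegral (hg j)).const_mul (a j))
    have e2 : ∀ i j, Integrable (fun e => a i * g i e * (a j * g j e)) μ := fun i j =>
      ((hg i).const_mul (a i)).integrable_mul ((hg j).const_mul (a j))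
    rw [integral_finsetSum _ fun i _ => integrable_finsetSum _ fun j _ => e1 i j,
      integral_finsetSum _ fun i _ => integrable_finsetSum _ fun j _ => e2 i j]
    refine Finset.sum_congr rfl fun i _ => ?_
    rw [integral_finsetSum _ fun j _ => e1 i j, integral_finsetSum _ fun j _ => e2 i j]
    refine Finset.sum_congr rfl fun j _ => ?_
    have e3 := hW.integral_simpleIntegral_mul (hg i) (hg j)
    calc _ = ∫ ω, (a i * a j) * (simpleIntegral W (g i) ω * simpleIntegral W (g j) ω) ∂P := by
          congr 1; ext ω; ring
      _ = ∫ e, (a i * a j) * (g i e * g j e) ∂μ := by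
          rw [integral_const_mul, e3, integral_const_mul]
      _ = _ := by congr 1; ext ω; ring
  · rw [integral_finsetSum _ fun i _ =>
      ((hW.memLp_simpleIntegral (hg i)).integrable (by norm_num)).const_mul (a i)]
    exact Finset.sum_eq_zero fun i _ => by
      rw [integral_const_mul, hW.integral_simpleIntegral (hg i), mul_zero]

lemma tendsto_eLpNorm_sum_sub {α ι : Type*} [MeasurableSpace α] {ν : Measure α} [Fintype ι]
    {F : ℕ → ι → α → ℝ} {f : ι → α → ℝ} (hF : ∀ k i, MemLp (F k i) 2 ν)
    (hf : ∀ i, MemLp (f i) 2 ν)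
    (h : ∀ i, Tendsto (fun k => eLpNorm (fun e => F k i e - f i e) 2 ν) atTop (𝓝 0))
    (a : ι → ℝ) :
    Tendsto (fun k => eLpNorm (fun e => (∑ i, a i * F k i e) - ∑ i, a i * f i e) 2 ν)
      atTop (𝓝 0) := by
  have hub : Tendsto (fun k => ∑ i, ‖a i‖ₑ * eLpNorm (fun e => F k i e - f i e) 2 ν)
      atTop (𝓝 0) := by
    rw [show (0 : ℝ≥0∞) = ∑ i : ι, ‖a i‖ₑ * 0 by simp]
    exact tendsto_finsetSum _ fun i _ => ENNReal.Tendsto.const_mul (h i) (Or.inr (by simp))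
  refine tendsto_of_tendsto_of_tendsto_of_le_of_le tendsto_const_nhds hub (fun _ => zero_le)
    fun k => ?_
  have : (fun e => (∑ i, a i * F k i e) - ∑ i, a i * f i e) =
      ∑ i, a i • (fun e => F k i e - f i e) := by
    ext e
    simp [Finset.sum_apply, ← Finset.sum_sub_distrib, mul_sub]
  rw [this]
  refine (eLpNorm_sum_le (fun i _ => (((hF k i).sub (hf i)).const_smul (a i)).1)
    (by norm_num)).trans (le_of_eq ?_)
  exact Finset.sum_congr rfl fun i _ => eLpNorm_const_smul _ _ _ _

lemma tendsto_integral_sq_of_tendsto_eLpNorm {α : Type*} [MeasurableSpace α] {ν : Measure α}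
    {F : ℕ → α → ℝ} {f : α → ℝ} (hF : ∀ k, MemLp (F k) 2 ν) (hf : MemLp f 2 ν)
    (h : Tendsto (fun k => eLpNorm (fun e => F k e - f e) 2 ν) atTop (𝓝 0)) :
    Tendsto (fun k => ∫ e, F k e ^ 2 ∂ν) atTop (𝓝 (∫ e, f e ^ 2 ∂ν)) := by
  have key : ∀ {u : α → ℝ} (hu : MemLp u 2 ν), ∫ e, u e ^ 2 ∂ν = ‖hu.toLp u‖ ^ 2 := by
    intro u hu
    rw [← real_inner_self_eq_norm_sq, L2.inner_def]
    refine integral_congr_ae ?_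
    filter_upwards [hu.coeFn_toLp] with e he
    simp [he, sq]
  have h1 := (Lp.tendsto_Lp_iff_tendsto_eLpNorm'' F hF f hf).2 h
  simp_rw [fun k => key (hF k), key hf]
  exact h1.norm.pow 2

/-- The characteristic function of a linear combination of stochastic integrals. -/
lemma IsWhiteNoise.integral_cexp_sum (hW : IsWhiteNoise μ P W) {ι : Type*} [Fintype ι]
    {f : ι → E → ℝ} {X : ι → Ω → ℝ} (hX : ∀ i, IsStochasticIntegral μ P W (f i) (X i))
    (a : ι → ℝ) :
    ∫ ω, Complex.exp ((∑ i, a i * X i ω : ℝ) * Complex.I) ∂P =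
      Complex.exp (-((∫ e, (∑ i, a i * f i e) ^ 2 ∂μ : ℝ) : ℂ) / 2) := by
  have := hW.gaussian.isProbabilityMeasure
  choose hf hXm g hg hgf hgX using hX
  have hI : ∀ k i, MemLp (simpleIntegral W (g i k)) 2 P := fun k i =>
    hW.memLp_simpleIntegral (hg i k)
  have hmF : ∀ k, MemLp (fun e => ∑ i, a i * g i k e) 2 μ := fun k =>
    memLp_finsetSum _ fun i _ => (hg i k).const_mul (a i)
  have hmf : MemLp (fun e => ∑ i, a i * f i e) 2 μ :=
    memLp_finsetSum _ fun i _ => (hf i).const_mul (a i)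
  have hmY : ∀ k, MemLp (fun ω => ∑ i, a i * simpleIntegral W (g i k) ω) 2 P := fun k =>
    memLp_finsetSum _ fun i _ => (hI k i).const_mul (a i)
  have hmX : MemLp (fun ω => ∑ i, a i * X i ω) 2 P :=
    memLp_finsetSum _ fun i _ => (hXm i).const_mul (a i)
  have hR := tendsto_integral_sq_of_tendsto_eLpNorm hmF hmf
    (tendsto_eLpNorm_sum_sub (F := fun k i => g i k) (fun k i => hg i k) hf hgf a)
  have hR' : Tendsto
      (fun k => Complex.exp (-((∫ e, (∑ i, a i * g i k e) ^ 2 ∂μ : ℝ) : ℂ) / 2)) atTop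
      (𝓝 (Complex.exp (-((∫ e, (∑ i, a i * f i e) ^ 2 ∂μ : ℝ) : ℂ) / 2))) := by
    have hc : Continuous fun r : ℝ => Complex.exp (-(r : ℂ) / 2) := by fun_prop
    exact (hc.tendsto _).comp hR
  have hL := tendsto_eLpNorm_sum_sub (F := fun k i => simpleIntegral W (g i k)) hI hXm hgX a
  have hint : ∀ {Y : Ω → ℝ}, MemLp Y 2 P →
      Integrable (fun ω => Complex.exp ((Y ω : ℂ) * Complex.I)) P := by
    intro Y hY
    refine Integrable.of_bound (C := 1) ?_ (ae_of_all _ fun ω => ?_)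
    · exact Complex.continuous_exp.comp_aestronglyMeasurable
        ((Complex.continuous_ofReal.comp_aestronglyMeasurable hY.1).mul_const _)
    · exact (Complex.norm_exp_ofReal_mul_I _).le
  have hL' : Tendsto (fun k => ∫ ω, Complex.exp
      ((∑ i, a i * simpleIntegral W (g i k) ω : ℝ) * Complex.I) ∂P) atTop
      (𝓝 (∫ ω, Complex.exp ((∑ i, a i * X i ω : ℝ) * Complex.I) ∂P)) := by
    -- Since `|exp(is) - exp(it)| ≤ |s - t|` and `P` is a probability measure, `L₂` convergence of
    -- the variables gives `L₁` convergence of the exponentials.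
    refine tendsto_integral_of_L1 _ (hint hmX).1 (Eventually.of_forall fun k => hint (hmY k)) ?_
    refine tendsto_of_tendsto_of_tendsto_of_le_of_le tendsto_const_nhds hL (fun _ => zero_le)
      fun k => ?_
    refine le_trans ?_ (eLpNorm_le_eLpNorm_of_exponent_le (p := 1) (by norm_num)
      ((hmY k).sub hmX).1)
    rw [eLpNorm_one_eq_lintegral_enorm]
    refine lintegral_mono fun ω => ?_
    rw [enorm_le_iff_norm_le]
    set s : ℝ := ∑ i, a i * simpleIntegral W (g i k) ω
    set t : ℝ := ∑ i, a i * X i ω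
    have h2 : Complex.exp (s * Complex.I) - Complex.exp (t * Complex.I) =
        Complex.exp (t * Complex.I) * (Complex.exp (Complex.I * (s - t : ℝ)) - 1) := by
      rw [mul_sub, ← Complex.exp_add]
      congr 2
      · push_cast; ring
      · ring
    rw [h2, norm_mul, Complex.norm_exp_ofReal_mul_I, one_mul]
    exact Real.norm_exp_I_mul_ofReal_sub_one_le
  have hEq : ∀ k, ∫ ω, Complex.exp
      ((∑ i, a i * simpleIntegral W (g i k) ω : ℝ) * Complex.I) ∂P =
      Complex.exp (-((∫ e, (∑ i, a i * g i k e) ^ 2 ∂μ : ℝ) : ℂ) / 2) := fun k =>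
    hW.integral_cexp_sum_simpleIntegral (fun i => hg i k) a
  simp_rw [hEq] at hL'
  exact tendsto_nhds_unique hL' hR'

end WhiteNoise

/-! ### Integrability of Brownian characteristic functions. -/

section MinForm

/-- The variance of `∑ c_j (B(u_j) - B(a))` for a Brownian motion `B`. -/
def minForm {n : ℕ} (a : ℝ) (u c : Fin n → ℝ) : ℝ :=
  ∑ j, ∑ k, c j * c k * (min (u j) (u k) - a)

@[fun_prop]
lemma continuous_minForm {n : ℕ} (a : ℝ) {X : Type*} [TopologicalSpace X]
    {f g : X → Fin n → ℝ} (hf : Continuous f) (hg : Continuous g) :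
    Continuous fun q => minForm a (f q) (g q) := by
  unfold minForm
  fun_prop

lemma measurable_ofReal_exp_minForm {n : ℕ} (κ a : ℝ) {X : Type*} [TopologicalSpace X]
    [MeasurableSpace X] [OpensMeasurableSpace X] {f g : X → Fin n → ℝ} (hf : Continuous f)
    (hg : Continuous g) :
    Measurable fun q => ENNReal.ofReal (Real.exp (-κ * minForm a (f q) (g q))) :=
  ENNReal.measurable_ofReal.comp (Continuous.measurable (by fun_prop))

/-- Independence of Brownian increments: with `m` the earliest time, the combination splits into `(t
+ ∑ c_j)(B(m) - B(a))` and `∑ c_j (B(u_j) - B(m))`, whose variances add. -/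
lemma minForm_insertNth {n : ℕ} (i : Fin (n + 1)) {a m : ℝ} {u : Fin n → ℝ}
    (hu : ∀ j, m ≤ u j) (t : ℝ) (c : Fin n → ℝ) :
    minForm a (i.insertNth m u : Fin (n + 1) → ℝ) (i.insertNth t c : Fin (n + 1) → ℝ) =
      (m - a) * (t + ∑ j, c j) ^ 2 + minForm m u c := by
  unfold minForm
  simp only [Fin.sum_univ_succAbove _ i, Fin.insertNth_apply_same, Fin.insertNth_apply_succAbove,
    min_self, min_eq_left (hu _), min_eq_right (hu _)]
  have h1 : ∀ j, t * c j * (m - a) = (m - a) * t * c j := fun j => by ring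
  have h2 : ∀ j, c j * t * (m - a) = (m - a) * t * c j := fun j => by ring
  have h3 : ∀ j k, c j * c k * (min (u j) (u k) - a) =
      (m - a) * (c j * c k) + c j * c k * (min (u j) (u k) - m) := fun j k => by ring
  simp only [h1, h2, h3, Finset.sum_add_distrib, ← Finset.mul_sum, ← Finset.sum_mul]
  ring

lemma lintegral_fin_succ {n : ℕ} (i : Fin (n + 1)) {f : (Fin (n + 1) → ℝ) → ℝ≥0∞}
    (hf : Measurable f) :
    ∫⁻ u, f u = ∫⁻ m : ℝ, ∫⁻ u : Fin n → ℝ, f (i.insertNth m u) := by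
  have h := (volume_preserving_piFinSuccAbove (fun _ : Fin (n + 1) => ℝ) i).symm
  rw [← h.lintegral_comp_emb (MeasurableEquiv.measurableEmbedding _), Measure.volume_eq_prod,
    lintegral_prod]
  · rfl
  · exact (hf.comp (MeasurableEquiv.measurable _)).aemeasurable

lemma lintegral_exp_neg_sq_eq {b : ℝ} (hb : 0 < b) :
    ∫⁻ t : ℝ, ENNReal.ofReal (Real.exp (-b * t ^ 2)) = ENNReal.ofReal (√(Real.pi / b)) := by
  rw [← integral_gaussian, ofReal_integral_eq_lintegral_ofReal (integrable_exp_neg_mul_sq hb)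
    (ae_of_all _ fun _ => (Real.exp_pos _).le)]

/-- The Gaussian integral equals `√(π / (κ s))`, an integrable singularity at `s = 0`. At `s = 0`
itself it is infinite, so that null point is removed. -/
lemma lintegral_lintegral_exp_neg_sq_lt_top {κ : ℝ} (hκ : 0 < κ) (L : ℝ) :
    ∫⁻ s in Set.Icc 0 L, ∫⁻ t : ℝ, ENNReal.ofReal (Real.exp (-(κ * s) * t ^ 2)) < ∞ := by
  rw [setLIntegral_congr Ioc_ae_eq_Icc.symm]
  have h1 : ∫⁻ s in Set.Ioc 0 L, ∫⁻ t : ℝ, ENNReal.ofReal (Real.exp (-(κ * s) * t ^ 2)) =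
      ∫⁻ s in Set.Ioc 0 L, ENNReal.ofReal (√(Real.pi / κ) * s ^ (-(1 / 2) : ℝ)) := by
    refine setLIntegral_congr_fun measurableSet_Ioc fun s hs => ?_
    rw [lintegral_exp_neg_sq_eq (mul_pos hκ hs.1), Real.rpow_neg hs.1.le, ← Real.sqrt_eq_rpow,
      ← Real.sqrt_inv, ← Real.sqrt_mul (by positivity)]
    congr 2
    field_simp
  rw [h1]
  rcases le_total L 0 with hL | hL
  · simp [hL]
  have h2 : IntervalIntegrable (fun s : ℝ => √(Real.pi / κ) * s ^ (-(1 / 2) : ℝ)) volume 0 L :=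
    (intervalIntegral.intervalIntegrable_rpow' (by norm_num)).const_mul _
  rw [intervalIntegrable_iff_integrableOn_Ioc_of_le hL] at h2
  refine lt_of_le_of_lt (lintegral_mono fun s => ?_) h2.2
  exact Real.ofReal_le_enorm _

/-- The integral of the characteristic functions of the finite dimensional increments of a
Brownian motion over all times in `[a, b]` is finite. -/
lemma exists_lintegral_exp_neg_minForm_le {κ : ℝ} (hκ : 0 < κ) (A b : ℝ) (n : ℕ) :
    ∃ C : ℝ≥0∞, C < ∞ ∧ ∀ a, A ≤ a →
      ∫⁻ u in Set.univ.pi (fun _ : Fin n => Set.Icc a b), ∫⁻ c : Fin n → ℝ,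
        ENNReal.ofReal (Real.exp (-κ * minForm a u c)) ≤ C := by
  -- Peeling off the earliest time `m` restarts the problem on `[m, b]`, so the constant has to be
  -- uniform over starting points `a ≥ A`.
  induction n with
  | zero =>
    refine ⟨1, by simp, fun a _ => ?_⟩
    have : IsProbabilityMeasure (volume : Measure (Fin 0 → ℝ)) := by
      rw [volume_pi, Measure.pi_of_empty]
      infer_instance
    simpa [minForm] using prob_le_one
  | succ n ih =>
    obtain ⟨C, hC, ih⟩ := ih
    set G : ℝ → ℝ≥0∞ := fun s => ∫⁻ t : ℝ, ENNReal.ofReal (Real.exp (-(κ * s) * t ^ 2)) with hG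
    have hGm : Measurable G := by
      refine Measurable.lintegral_prod_right' (f := fun q : ℝ × ℝ =>
        ENNReal.ofReal (Real.exp (-(κ * q.1) * q.2 ^ 2))) (by fun_prop)
    -- The factor `n + 1` counts the choices of the coordinate attaining the minimum. The sets `S i`
    -- below overlap on ties, which is harmless for an upper bound.
    refine ⟨(n + 1) * ((∫⁻ s in Set.Icc 0 (b - A), G s) * C), ?_, fun a ha => ?_⟩
    · exact ENNReal.mul_lt_top (by simp)
        (ENNReal.mul_lt_top (lintegral_lintegral_exp_neg_sq_lt_top hκ _) hC)
    set S : Fin (n + 1) → Set (Fin (n + 1) → ℝ) := fun i =>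
      {u | (∀ j, u i ≤ u j) ∧ ∀ j, u j ∈ Set.Icc a b} with hS
    have hSm : ∀ i, MeasurableSet (S i) := by
      intro i
      have : S i = (⋂ j, {u | u i ≤ u j}) ∩ ⋂ j, (fun u => u j) ⁻¹' Set.Icc a b := by
        ext u
        simp [hS]
      rw [this]
      exact ((isClosed_iInter fun j => isClosed_le (by fun_prop) (by fun_prop)).inter
        (isClosed_iInter fun j => isClosed_Icc.preimage (continuous_apply j))).measurableSet
    have hcover : Set.univ.pi (fun _ : Fin (n + 1) => Set.Icc a b) ⊆ ⋃ i, S i := by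
      intro u hu
      obtain ⟨i, hi⟩ := Finite.exists_min u
      exact Set.mem_iUnion.2 ⟨i, hi, fun j => hu j trivial⟩
    set Φ : (Fin (n + 1) → ℝ) → ℝ≥0∞ := fun u => ∫⁻ c : Fin (n + 1) → ℝ,
        ENNReal.ofReal (Real.exp (-κ * minForm a u c)) with hΦ
    have hΦm : Measurable Φ := by
      refine Measurable.lintegral_prod_right' (f := fun q : (Fin (n + 1) → ℝ) × (Fin (n + 1) → ℝ) =>
        ENNReal.ofReal (Real.exp (-κ * minForm a q.1 q.2))) ?_
      exact measurable_ofReal_exp_minForm _ _ (by fun_prop) (by fun_prop)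
    have hpiece : ∀ i, ∫⁻ u in S i, Φ u ≤ (∫⁻ s in Set.Icc 0 (b - A), G s) * C := by
      intro i
      rw [← lintegral_indicator (hSm i), lintegral_fin_succ i (hΦm.indicator (hSm i))]
      have hinner : ∀ m, ∫⁻ u : Fin n → ℝ, (S i).indicator Φ (i.insertNth m u) ≤
          (Set.Icc a b).indicator (fun m => G (m - a) * C) m := by
        intro m
        by_cases hm : m ∈ Set.Icc a b
        swap
        · have : ∀ u : Fin n → ℝ, (i.insertNth m u : Fin (n + 1) → ℝ) ∉ S i := by
            intro u hu
            apply hm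
            simpa using hu.2 i
          simp [this]
        rw [Set.indicator_of_mem hm]
        calc ∫⁻ u : Fin n → ℝ, (S i).indicator Φ (i.insertNth m u)
            ≤ ∫⁻ u : Fin n → ℝ, (Set.univ.pi fun _ : Fin n => Set.Icc m b).indicator
              (fun u => G (m - a) * ∫⁻ c : Fin n → ℝ,
                ENNReal.ofReal (Real.exp (-κ * minForm m u c))) u := by
              refine lintegral_mono fun u => ?_
              by_cases hu : (i.insertNth m u : Fin (n + 1) → ℝ) ∈ S i
              swap
              · simp [hu]
              have hmu : ∀ j, m ≤ u j := fun j => by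
                simpa using hu.1 (i.succAbove j)
              have hub : ∀ j, u j ≤ b := fun j => by
                simpa using (hu.2 (i.succAbove j)).2
              rw [Set.indicator_of_mem hu, Set.indicator_of_mem
                (show u ∈ Set.univ.pi fun _ : Fin n => Set.Icc m b from
                  fun j _ => ⟨hmu j, hub j⟩), hΦ]
              dsimp only
              rw [lintegral_fin_succ i (measurable_ofReal_exp_minForm κ a (by fun_prop)
                  (by fun_prop)),
                lintegral_lintegral_swap (measurable_ofReal_exp_minForm κ a (by fun_prop)
                  (by fun_prop)).aemeasurable,
                ← lintegral_const_mul]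
              swap
              · exact measurable_ofReal_exp_minForm _ _ (by fun_prop) (by fun_prop)
              refine lintegral_mono fun c => le_of_eq ?_
              have : ∀ t : ℝ, ENNReal.ofReal (Real.exp (-κ * minForm a
                  (i.insertNth m u : Fin (n + 1) → ℝ) (i.insertNth t c : Fin (n + 1) → ℝ))) =
                  ENNReal.ofReal (Real.exp (-(κ * (m - a)) * (t + ∑ j, c j) ^ 2)) *
                    ENNReal.ofReal (Real.exp (-κ * minForm m u c)) := by
                intro t
                rw [minForm_insertNth i hmu, ← ENNReal.ofReal_mul (Real.exp_pos _).le,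
                  ← Real.exp_add]
                congr 2
                ring
              simp_rw [this]
              -- Translation invariance in `t` absorbs the shift `∑ j, c j` and decouples the peeled
              -- frequency from the others.
              rw [lintegral_mul_const _ (by fun_prop), lintegral_add_right_eq_self
                (fun t : ℝ => ENNReal.ofReal (Real.exp (-(κ * (m - a)) * t ^ 2)))]
          _ = G (m - a) * ∫⁻ u in Set.univ.pi (fun _ : Fin n => Set.Icc m b),
                ∫⁻ c : Fin n → ℝ, ENNReal.ofReal (Real.exp (-κ * minForm m u c)) := by
              rw [lintegral_indicator (MeasurableSet.univ_pi fun _ => measurableSet_Icc),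
                lintegral_const_mul]
              refine Measurable.lintegral_prod_right' (f := fun q : (Fin n → ℝ) × (Fin n → ℝ) =>
                ENNReal.ofReal (Real.exp (-κ * minForm m q.1 q.2))) ?_
              exact measurable_ofReal_exp_minForm _ _ (by fun_prop) (by fun_prop)
          _ ≤ G (m - a) * C := by
              gcongr
              exact ih m (ha.trans hm.1)
      calc _ ≤ ∫⁻ m, (Set.Icc a b).indicator (fun m => G (m - a) * C) m := lintegral_mono hinner
        _ = ∫⁻ m, (Set.Icc 0 (b - a)).indicator (fun s => G s * C) (m - a) := by
          refine lintegral_congr fun m => ?_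
          simp only [Set.indicator_apply, Set.mem_Icc, sub_nonneg, sub_le_sub_iff_right]
        _ = ∫⁻ s, (Set.Icc 0 (b - a)).indicator (fun s => G s * C) s :=
          lintegral_sub_right_eq_self (fun s => (Set.Icc 0 (b - a)).indicator (fun s => G s * C) s) a
        _ = (∫⁻ s in Set.Icc 0 (b - a), G s) * C := by
          rw [lintegral_indicator measurableSet_Icc, lintegral_mul_const _ hGm]
        _ ≤ _ := by
          gcongr
    calc ∫⁻ u in Set.univ.pi (fun _ : Fin (n + 1) => Set.Icc a b), Φ u
        ≤ ∫⁻ u in ⋃ i, S i, Φ u := lintegral_mono_set hcover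
      _ ≤ ∑' i, ∫⁻ u in S i, Φ u := lintegral_iUnion_le _ _
      _ = ∑ i, ∫⁻ u in S i, Φ u := tsum_fintype _
      _ ≤ ∑ _i : Fin (n + 1), (∫⁻ s in Set.Icc 0 (b - A), G s) * C :=
        Finset.sum_le_sum fun i _ => hpiece i
      _ = _ := by simp

end MinForm

/-! ### The covariance of the solution in closed form. -/

section HeatKernel

@[fun_prop]
lemma continuous_heatKernel (t : ℝ) : Continuous (heatKernel t) := by
  unfold heatKernel
  fun_prop

lemma heatKernel_pos {t : ℝ} (ht : 0 < t) (u : ℝ) : 0 < heatKernel t u := by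
  unfold heatKernel
  positivity

lemma heatKernel_neg (t u : ℝ) : heatKernel t (-u) = heatKernel t u := by
  simp [heatKernel]

lemma heatKernel_le {t : ℝ} (ht : 0 < t) (u : ℝ) :
    heatKernel t u ≤ 1 / √(2 * Real.pi * t) := by
  unfold heatKernel
  refine mul_le_of_le_one_right (by positivity) (Real.exp_le_one_iff.2 ?_)
  rw [neg_div]
  exact neg_nonpos.2 (by positivity)

/-- The semigroup property, by completing the square around the midpoint `(u + w) / 2`. -/
lemma integral_heatKernel_mul_heatKernel {r : ℝ} (hr : 0 < r) (u w : ℝ) :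
    ∫ v, heatKernel r (u - v) * heatKernel r (w - v) = heatKernel (2 * r) (u - w) := by
  have h1 : ∀ v, heatKernel r (u - v) * heatKernel r (w - v) =
      (1 / (2 * Real.pi * r) * Real.exp (-(u - w) ^ 2 / (2 * (2 * r)))) *
        Real.exp (-(1 / r) * (v - (u + w) / 2) ^ 2) := by
    intro v
    unfold heatKernel
    rw [mul_mul_mul_comm, ← Real.exp_add, mul_assoc (1 / (2 * Real.pi * r)), ← Real.exp_add,
      div_mul_div_comm, Real.mul_self_sqrt (by positivity), one_mul]
    congr 2
    field_simp
    ring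
  simp_rw [h1]
  rw [integral_const_mul,
    integral_sub_right_eq_self (fun v : ℝ => Real.exp (-(1 / r) * v ^ 2)) ((u + w) / 2),
    integral_gaussian]
  unfold heatKernel
  have h2 : √(Real.pi / (1 / r)) = √(Real.pi * r) := by
    congr 1
    field_simp
  have h3 : √(2 * Real.pi * (2 * r)) = 2 * √(Real.pi * r) := by
    rw [show 2 * Real.pi * (2 * r) = 2 ^ 2 * (Real.pi * r) by ring, Real.sqrt_mul (by positivity),
      Real.sqrt_sq (by norm_num)]
  rw [h2, h3]
  have h4 : √(Real.pi * r) * √(Real.pi * r) = Real.pi * r := Real.mul_self_sqrt (by positivity)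
  have h5 : 0 < √(Real.pi * r) := Real.sqrt_pos.2 (by positivity)
  field_simp
  nlinarith [h4]

/-- The distribution function of the heat kernel at time `2`, shifted to vanish at `0`. -/
def heatCDF (h : ℝ) : ℝ := ∫ s in (0 : ℝ)..h, heatKernel 2 s

lemma hasDerivAt_heatCDF (h : ℝ) : HasDerivAt heatCDF (heatKernel 2 h) h :=
  intervalIntegral.integral_hasDerivAt_right ((continuous_heatKernel 2).intervalIntegrable _ _)
    ((continuous_heatKernel 2).stronglyMeasurableAtFilter _ _) (continuous_heatKernel 2).continuousAt

@[fun_prop]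
lemma continuous_heatCDF : Continuous heatCDF :=
  continuous_iff_continuousAt.2 fun h => (hasDerivAt_heatCDF h).continuousAt

lemma strictMono_heatCDF : StrictMono heatCDF :=
  strictMono_of_deriv_pos fun h => by
    rw [(hasDerivAt_heatCDF h).deriv]
    exact heatKernel_pos two_pos h

lemma heatCDF_neg (h : ℝ) : heatCDF (-h) = -heatCDF h := by
  unfold heatCDF
  have := intervalIntegral.integral_comp_neg (a := 0) (b := h) (heatKernel 2)
  simp only [heatKernel_neg, neg_zero] at this
  rw [this, intervalIntegral.integral_symm]

lemma tendsto_heatCDF : Tendsto heatCDF atTop (𝓝 (1 / 2)) := by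
  have h1 : ∀ s, heatKernel 2 s = 1 / √(2 * Real.pi * 2) * Real.exp (-(1 / 4) * s ^ 2) := by
    intro s
    unfold heatKernel
    congr 2
    ring
  have h2 : IntegrableOn (heatKernel 2) (Set.Ioi 0) := by
    rw [funext h1]
    exact ((integrable_exp_neg_mul_sq (by norm_num)).const_mul _).integrableOn
  have h3 := intervalIntegral_tendsto_integral_Ioi 0 h2 tendsto_id
  have h4 : ∫ s in Set.Ioi (0 : ℝ), heatKernel 2 s = 1 / 2 := by
    simp_rw [h1]
    rw [integral_const_mul, integral_gaussian_Ioi,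
      show 2 * Real.pi * 2 = Real.pi / (1 / 4) by ring]
    have : 0 < √(Real.pi / (1 / 4)) := Real.sqrt_pos.2 (by positivity)
    field_simp
  rw [h4] at h3
  exact h3

/-- Strictness here keeps `1 - 2 * heatCDF L` positive for every interval length `L`. -/
lemma heatCDF_lt (h : ℝ) : heatCDF h < 1 / 2 :=
  (strictMono_heatCDF (lt_add_one h)).trans_le
    (strictMono_heatCDF.monotone.ge_of_tendsto tendsto_heatCDF _)

/-- The even second antiderivative of the heat kernel at time `2`. -/
def heatPotential (h : ℝ) : ℝ := Real.exp (-h ^ 2 / 4) / √Real.pi + h * heatCDF h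

lemma heatKernel_two (h : ℝ) : heatKernel 2 h = Real.exp (-h ^ 2 / 4) / (2 * √Real.pi) := by
  unfold heatKernel
  rw [show 2 * Real.pi * 2 = 2 ^ 2 * Real.pi by ring, Real.sqrt_mul (by positivity),
    Real.sqrt_sq (by norm_num)]
  norm_num
  ring

lemma hasDerivAt_heatPotential (h : ℝ) : HasDerivAt heatPotential (heatCDF h) h := by
  have h1 : HasDerivAt (fun h : ℝ => Real.exp (-h ^ 2 / 4) / √Real.pi)
      (Real.exp (-h ^ 2 / 4) * (-(2 * h) / 4) / √Real.pi) h := by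
    have := (((hasDerivAt_pow 2 h).neg.div_const 4).exp).div_const √Real.pi
    simpa using this
  have h2 := (hasDerivAt_id h).mul (hasDerivAt_heatCDF h)
  refine (h1.add h2).congr_deriv ?_
  rw [heatKernel_two]
  simp only [id]
  field_simp
  ring

lemma heatPotential_neg (h : ℝ) : heatPotential (-h) = heatPotential h := by
  simp [heatPotential, heatCDF_neg]

/-- Integrating `heatPotential'' = heatKernel 2` twice leaves second differences of `heatPotential`.
-/
lemma integral_integral_heatKernel_sub (a b : ℝ) :
    ∫ s in (0 : ℝ)..a, ∫ t in (0 : ℝ)..b, heatKernel 2 (s - t) =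
      heatPotential a + heatPotential b - heatPotential (a - b) - heatPotential 0 := by
  have h1 : ∀ s, ∫ t in (0 : ℝ)..b, heatKernel 2 (s - t) = heatCDF s - heatCDF (s - b) := by
    intro s
    rw [intervalIntegral.integral_comp_sub_left, sub_zero]
    exact intervalIntegral.integral_eq_sub_of_hasDerivAt (fun x _ => hasDerivAt_heatCDF x)
      ((continuous_heatKernel 2).intervalIntegrable _ _)
  simp_rw [h1]
  have h2 : ∀ s : ℝ, HasDerivAt (fun s => heatPotential s - heatPotential (s - b))
      (heatCDF s - heatCDF (s - b)) s := fun s =>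
    (hasDerivAt_heatPotential s).sub ((hasDerivAt_heatPotential (s - b)).comp_sub_const s b)
  rw [intervalIntegral.integral_eq_sub_of_hasDerivAt (fun x _ => h2 x)
    (Continuous.intervalIntegrable (by fun_prop) _ _), zero_sub, heatPotential_neg]
  ring

/-- For `h ≥ 0`, scaling suggests the antiderivative `√r * heatPotential (h / √r) - h / 2` in `r`.
It tends to `0` at `0+`, because `heatCDF` tends to `1 / 2` at infinity; evenness covers `h < 0`. -/
lemma integral_heatKernel_time (h : ℝ) :
    ∫ r in (0 : ℝ)..1, heatKernel (2 * r) h = heatPotential h - |h| / 2 := by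
  wlog hh : 0 ≤ h generalizing h
  · have := this (-h) (by linarith)
    simpa [heatKernel_neg, heatPotential_neg] using this
  rw [abs_of_nonneg hh]
  have hder : ∀ r ∈ Set.Ioo (0 : ℝ) 1,
      HasDerivAt (fun r => √r * heatPotential (h / √r) - h / 2) (heatKernel (2 * r) h) r := by
    intro r hr
    have hr0 := hr.1
    have hs : 0 < √r := Real.sqrt_pos.2 hr0
    have hsq : √r ^ 2 = r := Real.sq_sqrt hr0.le
    have h1 : HasDerivAt (fun r => √r) (1 / (2 * √r)) r := Real.hasDerivAt_sqrt hr0.ne'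
    have h2 : HasDerivAt (fun r => h / √r) (-(h * (1 / (2 * √r))) / √r ^ 2) r := by
      refine ((hasDerivAt_const r h).fun_div h1 hs.ne').congr_deriv ?_
      ring
    have h3 := (h1.mul ((hasDerivAt_heatPotential (h / √r)).comp r h2)).sub_const (h / 2)
    refine h3.congr_deriv ?_
    simp only [Function.comp_apply, heatPotential, heatKernel]
    have e1 : √(2 * Real.pi * (2 * r)) = 2 * √Real.pi * √r := by
      rw [show 2 * Real.pi * (2 * r) = 2 ^ 2 * Real.pi * r by ring, Real.sqrt_mul (by positivity),
        Real.sqrt_mul (by positivity), Real.sqrt_sq (by norm_num)]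
    have e2 : -h ^ 2 / (2 * (2 * r)) = -(h / √r) ^ 2 / 4 := by
      rw [div_pow, hsq]
      field_simp
      norm_num
    rw [e1, e2]
    field_simp
    ring
  -- The kernel is at most `1 / √(4πr)`, hence at most the integrable function `r^(-1/2)`.
  have hint : IntervalIntegrable (fun r => heatKernel (2 * r) h) volume 0 1 := by
    have hb : IntervalIntegrable (fun r : ℝ => r ^ (-(1 / 2) : ℝ)) volume 0 1 :=
      intervalIntegral.intervalIntegrable_rpow' (by norm_num)
    refine hb.mono_fun ?_ ?_
    · refine Measurable.aestronglyMeasurable ?_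
      unfold heatKernel
      fun_prop
    · rw [Set.uIoc_of_le zero_le_one]
      filter_upwards [ae_restrict_mem measurableSet_Ioc] with r hr
      have hr0 : 0 < r := hr.1
      rw [Real.norm_of_nonneg (heatKernel_pos (by positivity) h).le,
        Real.norm_of_nonneg (by positivity)]
      refine (heatKernel_le (by positivity) h).trans ?_
      rw [Real.rpow_neg hr0.le, ← Real.sqrt_eq_rpow, one_div]
      refine inv_anti₀ (Real.sqrt_pos.2 hr0) (Real.sqrt_le_sqrt ?_)
      nlinarith [Real.pi_gt_three]
  have h0 : Tendsto (fun r => √r * heatPotential (h / √r) - h / 2) (𝓝[>] 0) (𝓝 0) := by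
    have hsqrt : Tendsto (fun r : ℝ => √r) (𝓝[>] 0) (𝓝 0) := by
      have := (Real.continuous_sqrt.tendsto 0).mono_left (nhdsWithin_le_nhds (s := Set.Ioi 0))
      simpa using this
    have hsqrt' : Tendsto (fun r : ℝ => √r) (𝓝[>] 0) (𝓝[>] 0) :=
      tendsto_nhdsWithin_iff.2 ⟨hsqrt, by
        filter_upwards [self_mem_nhdsWithin] with r hr using Real.sqrt_pos.2 hr⟩
    have h1 : Tendsto (fun r : ℝ => √r * (Real.exp (-(h / √r) ^ 2 / 4) / √Real.pi))
        (𝓝[>] 0) (𝓝 0) := by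
      have hub : Tendsto (fun r : ℝ => √r * (1 / √Real.pi)) (𝓝[>] 0) (𝓝 0) := by
        simpa using hsqrt.mul_const (1 / √Real.pi)
      refine squeeze_zero (fun r => by positivity) (fun r => ?_) hub
      gcongr
      refine Real.exp_le_one_iff.2 ?_
      rw [neg_div]
      exact neg_nonpos.2 (by positivity)
    have h2 : Tendsto (fun r : ℝ => h * (heatCDF (h / √r) - 1 / 2)) (𝓝[>] 0) (𝓝 0) := by
      rcases hh.eq_or_lt with rfl | hpos
      · simp
      · have h3 : Tendsto (fun r : ℝ => h / √r) (𝓝[>] 0) atTop := by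
          simp_rw [div_eq_mul_inv]
          exact (tendsto_inv_nhdsGT_zero.comp hsqrt').const_mul_atTop hpos
        have h4 := ((tendsto_heatCDF.comp h3).sub_const (1 / 2)).const_mul h
        simpa using h4
    have h5 := h1.add h2
    rw [add_zero] at h5
    refine h5.congr' ?_
    filter_upwards [self_mem_nhdsWithin] with r hr
    have hs : √r ≠ 0 := (Real.sqrt_pos.2 hr).ne'
    unfold heatPotential
    field_simp
    ring
  have h1 : Tendsto (fun r => √r * heatPotential (h / √r) - h / 2) (𝓝[<] 1)
      (𝓝 (heatPotential h - h / 2)) := by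
    have hc : ContinuousAt (fun r => √r * heatPotential (h / √r) - h / 2) 1 := by
      have hQ : Continuous heatPotential :=
        continuous_iff_continuousAt.2 fun x => (hasDerivAt_heatPotential x).continuousAt
      have hd : ContinuousAt (fun r => h / √r) 1 :=
        continuousAt_const.div Real.continuous_sqrt.continuousAt (by simp)
      exact (Real.continuous_sqrt.continuousAt.mul
        (hQ.continuousAt.comp hd)).sub continuousAt_const
    have := hc.tendsto.mono_left (nhdsWithin_le_nhds (s := Set.Iio 1))
    simpa using this
  rw [intervalIntegral.integral_eq_sub_of_hasDerivAt_of_tendsto zero_lt_one hder hint h0 h1,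
    sub_zero]

/-- The covariance of the solution of the heat equation at time `1`. -/
lemma integral_heatIntegrand_mul {u w : ℝ} (hu : MemLp (heatIntegrand 1 u) 2 spaceTimeMeasure)
    (hw : MemLp (heatIntegrand 1 w) 2 spaceTimeMeasure) :
    ∫ q, heatIntegrand 1 u q * heatIntegrand 1 w q ∂spaceTimeMeasure =
      heatPotential (u - w) - |u - w| / 2 := by
  have hint : Integrable (fun q => heatIntegrand 1 u q * heatIntegrand 1 w q) spaceTimeMeasure :=
    hu.integrable_mul hw
  have hμ : spaceTimeMeasure = (volume : Measure ℝ).prod (volume.restrict (Set.Ici 0)) := by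
    rw [spaceTimeMeasure, Measure.volume_eq_prod, ← Measure.prod_restrict, Measure.restrict_univ]
  rw [hμ] at hint ⊢
  have h1 : ∀ s : ℝ, ∫ v, heatIntegrand 1 u (v, s) * heatIntegrand 1 w (v, s) =
      (Set.Ico 0 1).indicator (fun s => heatKernel (2 * (1 - s)) (u - w)) s := by
    intro s
    by_cases hs : s ∈ Set.Ico (0 : ℝ) 1
    · have : 0 < 1 - s := by linarith [hs.2]
      simp only [heatIntegrand, Set.indicator, Set.mem_prod, Set.mem_univ, true_and, hs, if_true]
      exact integral_heatKernel_mul_heatKernel this u w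
    · simp [heatIntegrand, Set.indicator, hs]
  rw [integral_prod_symm _ hint]
  simp_rw [h1]
  rw [setIntegral_indicator measurableSet_Ico, Set.inter_eq_right.2 Set.Ico_subset_Ici_self,
    integral_Ico_eq_integral_Ioo, ← integral_Ioc_eq_integral_Ioo,
    ← intervalIntegral.integral_of_le zero_le_one,
    intervalIntegral.integral_comp_sub_left (fun r => heatKernel (2 * r) (u - w)) 1]
  simpa using integral_heatKernel_time (u - w)

end HeatKernel

/-! ### Comparison of the increments with Brownian motion. -/

section Nondeterminism

/-- A Schur test. With `f = ∑ c_j 1_(0, a_j]`, the left side is the quadratic form of the kernel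
`p_2(s - t)` at `f`, and `minForm 0 a c = ∫ f²`. -/
lemma sum_mul_integral_heatKernel_le {n : ℕ} {L : ℝ} (hL : 0 ≤ L) {a : Fin n → ℝ}
    (ha : ∀ j, a j ∈ Set.Icc 0 L) (c : Fin n → ℝ) :
    ∑ j, ∑ k, c j * c k * ∫ s in (0 : ℝ)..a j, ∫ t in (0 : ℝ)..a k, heatKernel 2 (s - t) ≤
      2 * heatCDF L * minForm 0 a c := by
  set ν : Measure ℝ := volume.restrict (Set.Ioc 0 L) with hν
  let χ : Fin n → ℝ → ℝ := fun j => (Set.Ioc 0 (a j)).indicator 1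
  have hχm : ∀ j, Measurable (χ j) := fun j => measurable_one.indicator measurableSet_Ioc
  have hχ0 : ∀ j s, ‖χ j s‖ ≤ 1 := fun j s => by
    by_cases h : s ∈ Set.Ioc 0 (a j) <;> simp [χ, h]
  have hχν : ∀ j (g : ℝ → ℝ), ∫ s, χ j s * g s ∂ν = ∫ s in (0 : ℝ)..a j, g s := by
    intro j g
    have : ∀ s, χ j s * g s = (Set.Ioc 0 (a j)).indicator g s := fun s => by
      by_cases h : s ∈ Set.Ioc 0 (a j) <;> simp [χ, h]
    simp_rw [this]
    rw [hν, setIntegral_indicator measurableSet_Ioc,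
      Set.inter_eq_right.2 (Set.Ioc_subset_Ioc_right (ha j).2),
      intervalIntegral.integral_of_le (ha j).1]
  let f : ℝ → ℝ := fun s => ∑ j, c j * χ j s
  have hfm : Measurable f := Finset.measurable_sum _ fun j _ => (hχm j).const_mul _
  have hfb : ∀ s, ‖f s‖ ≤ ∑ j, ‖c j‖ := fun s => by
    refine (norm_sum_le _ _).trans (Finset.sum_le_sum fun j _ => ?_)
    rw [norm_mul]
    exact mul_le_of_le_one_right (norm_nonneg _) (hχ0 j s)
  have hk0 : ∀ x, 0 ≤ heatKernel 2 x := fun x => (heatKernel_pos two_pos x).le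
  have hkb : ∀ x, ‖heatKernel 2 x‖ ≤ 1 / √(2 * Real.pi * 2) := fun x => by
    rw [Real.norm_of_nonneg (hk0 x)]
    exact heatKernel_le two_pos x
  have hkm : Measurable fun q : ℝ × ℝ => heatKernel 2 (q.1 - q.2) :=
    Continuous.measurable (by fun_prop)
  have hI1 : ∀ j k, Integrable (fun q : ℝ × ℝ => χ j q.1 * (χ k q.2 * heatKernel 2 (q.1 - q.2)))
      (ν.prod ν) := fun j k => by
    refine Integrable.of_bound (C := 1 * (1 * (1 / √(2 * Real.pi * 2)))) ?_ (ae_of_all _ fun q => ?_)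
    · exact (((hχm j).comp measurable_fst).mul
        (((hχm k).comp measurable_snd).mul hkm)).aestronglyMeasurable
    · rw [norm_mul, norm_mul]
      gcongr
      exacts [hχ0 _ _, hχ0 _ _, hkb _]
  have hI0 : Integrable (fun q : ℝ × ℝ => f q.1 * f q.2 * heatKernel 2 (q.1 - q.2))
      (ν.prod ν) := by
    refine Integrable.of_bound (C := (∑ j, ‖c j‖) * (∑ j, ‖c j‖) * (1 / √(2 * Real.pi * 2))) ?_
      (ae_of_all _ fun q => ?_)
    · exact (((hfm.comp measurable_fst).mul (hfm.comp measurable_snd)).mul hkm).aestronglyMeasurable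
    · rw [norm_mul, norm_mul]
      gcongr
      exacts [hfb _, hfb _, hkb _]
  have hI2 : Integrable (fun q : ℝ × ℝ => f q.1 ^ 2 * heatKernel 2 (q.1 - q.2)) (ν.prod ν) := by
    refine Integrable.of_bound (C := (∑ j, ‖c j‖) ^ 2 * (1 / √(2 * Real.pi * 2))) ?_
      (ae_of_all _ fun q => ?_)
    · exact (((hfm.comp measurable_fst).pow_const 2).mul hkm).aestronglyMeasurable
    · rw [norm_mul, norm_pow]
      gcongr
      exacts [hfb _, hkb _]
  have hI3 : Integrable (fun q : ℝ × ℝ => f q.2 ^ 2 * heatKernel 2 (q.1 - q.2)) (ν.prod ν) := by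
    have := hI2.swap
    refine this.congr (ae_of_all _ fun q => ?_)
    simp only [Function.comp_apply, Prod.fst_swap, Prod.snd_swap]
    rw [← heatKernel_neg, neg_sub]
  have hf2 : Integrable (fun s => f s ^ 2) ν := by
    refine Integrable.of_bound (C := (∑ j, ‖c j‖) ^ 2) (hfm.pow_const 2).aestronglyMeasurable
      (ae_of_all _ fun q => ?_)
    rw [norm_pow]
    gcongr
    exact hfb _
  have hLHS : ∑ j, ∑ k, c j * c k * ∫ s in (0 : ℝ)..a j, ∫ t in (0 : ℝ)..a k, heatKernel 2 (s - t)
      = ∫ q, f q.1 * f q.2 * heatKernel 2 (q.1 - q.2) ∂(ν.prod ν) := by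
    have h1 : ∀ q : ℝ × ℝ, f q.1 * f q.2 * heatKernel 2 (q.1 - q.2) =
        ∑ j, ∑ k, c j * c k * (χ j q.1 * (χ k q.2 * heatKernel 2 (q.1 - q.2))) := fun q => by
      simp only [f]
      rw [Finset.sum_mul_sum, Finset.sum_mul]
      refine Finset.sum_congr rfl fun j _ => ?_
      rw [Finset.sum_mul]
      exact Finset.sum_congr rfl fun k _ => by ring
    simp_rw [h1]
    rw [integral_finsetSum _ fun j _ => integrable_finsetSum _ fun k _ => (hI1 j k).const_mul _]
    refine Finset.sum_congr rfl fun j _ => ?_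
    rw [integral_finsetSum _ fun k _ => (hI1 j k).const_mul _]
    refine Finset.sum_congr rfl fun k _ => ?_
    rw [integral_const_mul, integral_prod _ (hI1 j k)]
    simp_rw [integral_const_mul, hχν]
  have hRHS : ∫ s, f s ^ 2 ∂ν = minForm 0 a c := by
    have h1 : ∀ s, f s ^ 2 = ∑ j, ∑ k, c j * c k * (χ j s * χ k s) := fun s => by
      simp only [f, sq]
      rw [Finset.sum_mul_sum]
      exact Finset.sum_congr rfl fun j _ => Finset.sum_congr rfl fun k _ => by ring
    have hI : ∀ j k, Integrable (fun s => χ j s * χ k s) ν := fun j k => by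
      refine Integrable.of_bound (C := 1 * 1) ((hχm j).mul (hχm k)).aestronglyMeasurable
        (ae_of_all _ fun s => ?_)
      rw [norm_mul]
      gcongr
      exacts [hχ0 _ _, hχ0 _ _]
    simp_rw [h1]
    rw [integral_finsetSum _ fun j _ => integrable_finsetSum _ fun k _ => (hI j k).const_mul _]
    refine Finset.sum_congr rfl fun j _ => ?_
    rw [integral_finsetSum _ fun k _ => (hI j k).const_mul _]
    refine Finset.sum_congr rfl fun k _ => ?_
    rw [integral_const_mul, hχν, intervalIntegral.integral_of_le (ha j).1]
    simp only [χ]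
    rw [setIntegral_indicator measurableSet_Ioc, Set.Ioc_inter_Ioc]
    simp [le_min (ha j).1 (ha k).1]
  -- The row integral is `heatCDF s + heatCDF (L - s)`, and both arguments are at most `L`.
  have hinner : ∀ s ∈ Set.Ioc 0 L, ∫ t, heatKernel 2 (s - t) ∂ν ≤ 2 * heatCDF L := by
    intro s hs
    rw [hν, ← intervalIntegral.integral_of_le hL, intervalIntegral.integral_comp_sub_left, sub_zero,
      intervalIntegral.integral_eq_sub_of_hasDerivAt (fun x _ => hasDerivAt_heatCDF x)
      ((continuous_heatKernel 2).intervalIntegrable _ _), ← neg_sub L s, heatCDF_neg]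
    have h1 := strictMono_heatCDF.monotone hs.2
    have h2 := strictMono_heatCDF.monotone (show L - s ≤ L by linarith [hs.1])
    linarith
  have hsym : ∫ q : ℝ × ℝ, f q.2 ^ 2 * heatKernel 2 (q.1 - q.2) ∂(ν.prod ν) =
      ∫ q : ℝ × ℝ, f q.1 ^ 2 * heatKernel 2 (q.1 - q.2) ∂(ν.prod ν) := by
    rw [← integral_prod_swap]
    refine integral_congr_ae (ae_of_all _ fun q => ?_)
    simp only [Prod.fst_swap, Prod.snd_swap]
    rw [← heatKernel_neg, neg_sub]
  have hdiag : ∫ q : ℝ × ℝ, f q.1 ^ 2 * heatKernel 2 (q.1 - q.2) ∂(ν.prod ν) ≤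
      2 * heatCDF L * ∫ s, f s ^ 2 ∂ν := by
    rw [integral_prod _ hI2, ← integral_const_mul]
    refine integral_mono_ae hI2.integral_prod_left (hf2.const_mul _) ?_
    filter_upwards [ae_restrict_mem measurableSet_Ioc] with s hs
    rw [integral_const_mul, mul_comm (2 * heatCDF L)]
    gcongr
    exact hinner s hs
  rw [hLHS, ← hRHS]
  refine le_trans ?_ hdiag
  -- The kernel is nonnegative, so `2 f(s) f(t) ≤ f(s)² + f(t)²` may be integrated against it; by
  -- symmetry both squares contribute equally.
  calc ∫ q, f q.1 * f q.2 * heatKernel 2 (q.1 - q.2) ∂(ν.prod ν)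
      ≤ ∫ q, (1 / 2 * (f q.1 ^ 2 * heatKernel 2 (q.1 - q.2)) +
          1 / 2 * (f q.2 ^ 2 * heatKernel 2 (q.1 - q.2))) ∂(ν.prod ν) := by
        refine integral_mono hI0 ((hI2.const_mul _).add (hI3.const_mul _)) fun q => ?_
        dsimp only [Pi.add_apply]
        nlinarith [mul_nonneg (sq_nonneg (f q.1 - f q.2)) (hk0 (q.1 - q.2))]
    _ = _ := by
        rw [integral_add (hI2.const_mul _) (hI3.const_mul _), integral_const_mul,
          integral_const_mul, hsym]
        ring

/-- The increments of the solution are locally nondeterministic: the variance of a linear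
combination dominates the one for a Brownian motion. -/
lemma le_integral_sq_sum_heatIntegrand {n : ℕ} {U₁ U₂ : ℝ} (hU : U₁ ≤ U₂)
    (hm : ∀ u, MemLp (heatIntegrand 1 u) 2 spaceTimeMeasure) {u : Fin n → ℝ}
    (hu : ∀ j, u j ∈ Set.Icc U₁ U₂) (c : Fin n → ℝ) :
    (1 - 2 * heatCDF (U₂ - U₁)) * minForm U₁ u c ≤
      ∫ q, (∑ j, c j * (heatIntegrand 1 (u j) q - heatIntegrand 1 U₁ q)) ^ 2
        ∂spaceTimeMeasure := by
  have hI : ∀ v w, Integrable (fun q => heatIntegrand 1 v q * heatIntegrand 1 w q)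
      spaceTimeMeasure := fun v w => (hm v).integrable_mul (hm w)
  -- The absolute values in the four covariances combine to `min v w - U₁`, and the values of
  -- `heatPotential` to minus the double integral.
  have hpair : ∀ v w, U₁ ≤ v → U₁ ≤ w →
      Integrable (fun q => (heatIntegrand 1 v q - heatIntegrand 1 U₁ q) *
        (heatIntegrand 1 w q - heatIntegrand 1 U₁ q)) spaceTimeMeasure ∧
      ∫ q, (heatIntegrand 1 v q - heatIntegrand 1 U₁ q) *
        (heatIntegrand 1 w q - heatIntegrand 1 U₁ q) ∂spaceTimeMeasure =
      (min v w - U₁) -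
        ∫ s in (0 : ℝ)..(v - U₁), ∫ t in (0 : ℝ)..(w - U₁), heatKernel 2 (s - t) := by
    intro v w hv hw
    refine ⟨((hm v).sub (hm U₁)).integrable_mul ((hm w).sub (hm U₁)), ?_⟩
    have h1 : ∀ q, (heatIntegrand 1 v q - heatIntegrand 1 U₁ q) *
        (heatIntegrand 1 w q - heatIntegrand 1 U₁ q) =
        heatIntegrand 1 v q * heatIntegrand 1 w q - heatIntegrand 1 v q * heatIntegrand 1 U₁ q -
        (heatIntegrand 1 U₁ q * heatIntegrand 1 w q -
          heatIntegrand 1 U₁ q * heatIntegrand 1 U₁ q) := fun q => by ring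
    simp_rw [h1]
    have hmin : min v w = (v + w - |v - w|) / 2 := by
      linarith [min_add_max v w, max_sub_min_eq_abs' v w]
    have hI' : ∀ v w v' w', Integrable (fun q => heatIntegrand 1 v q * heatIntegrand 1 w q -
        heatIntegrand 1 v' q * heatIntegrand 1 w' q) spaceTimeMeasure := fun v w v' w' =>
      (hI v w).sub (hI v' w')
    rw [integral_sub (hI' _ _ _ _) (hI' _ _ _ _), integral_sub (hI _ _) (hI _ _),
      integral_sub (hI _ _) (hI _ _),
      integral_heatIntegrand_mul (hm _) (hm _), integral_heatIntegrand_mul (hm _) (hm _),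
      integral_heatIntegrand_mul (hm _) (hm _), integral_heatIntegrand_mul (hm _) (hm _),
      integral_integral_heatKernel_sub, ← neg_sub w U₁, heatPotential_neg, abs_neg,
      abs_of_nonneg (sub_nonneg.2 hv), abs_of_nonneg (sub_nonneg.2 hw), sub_self, abs_zero,
      sub_sub_sub_cancel_right, hmin]
    ring
  have hexp : ∫ q, (∑ j, c j * (heatIntegrand 1 (u j) q - heatIntegrand 1 U₁ q)) ^ 2
      ∂spaceTimeMeasure = minForm U₁ u c - ∑ j, ∑ k, c j * c k *
        ∫ s in (0 : ℝ)..(u j - U₁), ∫ t in (0 : ℝ)..(u k - U₁), heatKernel 2 (s - t) := by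
    have h1 : ∀ q, (∑ j, c j * (heatIntegrand 1 (u j) q - heatIntegrand 1 U₁ q)) ^ 2 =
        ∑ j, ∑ k, c j * c k * ((heatIntegrand 1 (u j) q - heatIntegrand 1 U₁ q) *
          (heatIntegrand 1 (u k) q - heatIntegrand 1 U₁ q)) := fun q => by
      rw [sq, Finset.sum_mul_sum]
      exact Finset.sum_congr rfl fun j _ => Finset.sum_congr rfl fun k _ => by ring
    simp_rw [h1]
    rw [integral_finsetSum _ fun j _ => integrable_finsetSum _ fun k _ =>
      (hpair _ _ (hu j).1 (hu k).1).1.const_mul _, minForm, ← Finset.sum_sub_distrib]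
    refine Finset.sum_congr rfl fun j _ => ?_
    rw [integral_finsetSum _ fun k _ => (hpair _ _ (hu j).1 (hu k).1).1.const_mul _,
      ← Finset.sum_sub_distrib]
    refine Finset.sum_congr rfl fun k _ => ?_
    rw [integral_const_mul, (hpair _ _ (hu j).1 (hu k).1).2]
    ring
  have hshift : minForm U₁ u c = minForm 0 (fun j => u j - U₁) c := by
    simp only [minForm, min_sub_sub_right, sub_zero]
  have := sum_mul_integral_heatKernel_le (sub_nonneg.2 hU)
    (a := fun j => u j - U₁) (fun j => ⟨by linarith [(hu j).1], by linarith [(hu j).2]⟩) c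
  rw [hexp]
  rw [← hshift] at this
  linarith

end Nondeterminism

/-! ### Fourier representation and moments of the approximations. -/

section Moments

/-- The Fourier transform of `p_ε - p_δ`. -/
def symbolDiff (ε δ c : ℝ) : ℝ := Real.exp (-(ε / 2) * c ^ 2) - Real.exp (-(δ / 2) * c ^ 2)

lemma integrable_symbolDiff {ε δ : ℝ} (hε : 0 < ε) (hδ : 0 < δ) :
    Integrable (symbolDiff ε δ) :=
  (integrable_exp_neg_mul_sq (half_pos hε)).sub (integrable_exp_neg_mul_sq (half_pos hδ))

@[fun_prop]
lemma continuous_symbolDiff (ε δ : ℝ) : Continuous (symbolDiff ε δ) := by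
  unfold symbolDiff
  fun_prop

lemma norm_symbolDiff_le_one {ε δ : ℝ} (hε : 0 < ε) (hδ : 0 < δ) (c : ℝ) :
    ‖symbolDiff ε δ c‖ ≤ 1 := by
  have h : ∀ {ε : ℝ}, 0 < ε → 0 ≤ Real.exp (-(ε / 2) * c ^ 2) ∧
      Real.exp (-(ε / 2) * c ^ 2) ≤ 1 := fun {ε} h =>
    ⟨(Real.exp_pos _).le, Real.exp_le_one_iff.2 (by nlinarith [sq_nonneg c])⟩
  rw [symbolDiff, Real.norm_eq_abs, abs_le]
  constructor <;> linarith [(h hε).1, (h hε).2, (h hδ).1, (h hδ).2]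

lemma integrable_cexp_mul {g : ℝ → ℝ} (hg : Integrable g) (x : ℝ) :
    Integrable fun c : ℝ => Complex.exp ((c * x : ℝ) * Complex.I) * (g c : ℂ) := by
  refine (hg.ofReal (𝕜 := ℂ)).bdd_mul (c := 1) ?_ (ae_of_all _ fun c => ?_)
  · exact (Continuous.aestronglyMeasurable (by fun_prop))
  · exact (Complex.norm_exp_ofReal_mul_I _).le

lemma ofReal_heatKernel {ε : ℝ} (hε : 0 < ε) (x : ℝ) :
    (heatKernel ε x : ℂ) = (1 / (2 * Real.pi) : ℝ) * ∫ c : ℝ,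
      Complex.exp ((c * x : ℝ) * Complex.I) * (Real.exp (-(ε / 2) * c ^ 2) : ℝ) := by
  have hb : 0 < ((ε / 2 : ℝ) : ℂ).re := by simpa using hε
  have h := fourierIntegral_gaussian hb (x : ℂ)
  have h1 : ∀ c : ℝ, Complex.exp (Complex.I * x * c) * Complex.exp (-((ε / 2 : ℝ) : ℂ) * c ^ 2) =
      Complex.exp ((c * x : ℝ) * Complex.I) * (Real.exp (-(ε / 2) * c ^ 2) : ℝ) := by
    intro c
    push_cast
    congr 2
    ring
  simp_rw [h1] at h
  rw [h]
  have h2 : ((Real.pi : ℂ) / ((ε / 2 : ℝ) : ℂ)) ^ (1 / 2 : ℂ) = (√(Real.pi / (ε / 2)) : ℝ) := by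
    rw [Real.sqrt_eq_rpow, Complex.ofReal_cpow (by positivity)]
    push_cast
    rfl
  have h3 : Complex.exp (-(x : ℂ) ^ 2 / (4 * ((ε / 2 : ℝ) : ℂ))) =
      (Real.exp (-x ^ 2 / (2 * ε)) : ℝ) := by
    push_cast
    congr 1
    field_simp
    norm_num
  rw [h2, h3, ← Complex.ofReal_mul, ← Complex.ofReal_mul]
  congr 1
  unfold heatKernel
  rw [← mul_assoc]
  congr 1
  rw [show Real.pi / (ε / 2) = (2 * Real.pi * 2 * Real.pi) / (2 * Real.pi * ε) by field_simp,
    Real.sqrt_div (by positivity),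
    show 2 * Real.pi * 2 * Real.pi = (2 * Real.pi) ^ 2 by ring, Real.sqrt_sq (by positivity)]
  field_simp

lemma ofReal_heatKernel_sub {ε δ : ℝ} (hε : 0 < ε) (hδ : 0 < δ) (x : ℝ) :
    ((heatKernel ε x - heatKernel δ x : ℝ) : ℂ) = (1 / (2 * Real.pi) : ℝ) * ∫ c : ℝ,
      Complex.exp ((c * x : ℝ) * Complex.I) * (symbolDiff ε δ c : ℝ) := by
  rw [Complex.ofReal_sub, ofReal_heatKernel hε, ofReal_heatKernel hδ, ← mul_sub, ← integral_sub
    (integrable_cexp_mul (integrable_exp_neg_mul_sq (half_pos hε)) x)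
    (integrable_cexp_mul (integrable_exp_neg_mul_sq (half_pos hδ)) x)]
  simp_rw [← mul_sub, ← Complex.ofReal_sub]
  rfl

lemma localTimeApprox_eq {Ω : Type*} [MeasurableSpace Ω] {y : ℝ → Ω → ℝ} {T₁ T₂ : ℝ}
    (hT : T₁ ≤ T₂) (z ε : ℝ) (ω : Ω) :
    localTimeApprox y T₁ T₂ z ε ω = ∫ u in Set.Icc T₁ T₂, heatKernel ε (y u ω - z) := by
  rw [localTimeApprox, intervalIntegral.integral_of_le hT, integral_Icc_eq_integral_Ioc]

variable {Ω : Type*} [MeasurableSpace Ω] {P : Measure Ω} [IsProbabilityMeasure P]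

/-- Fourier inversion in each factor and Fubini, licensed by the Gaussian decay of the symbols for
fixed `ε, δ`, leave the joint characteristic function of the `Y j` under the frequency integral. The
phases from `z` have modulus one, and `(2π)^(-n) ≤ 1` is dropped. -/
lemma enorm_integral_prod_heatKernel_sub_le {n : ℕ} {Y : Fin n → Ω → ℝ}
    (hY : ∀ j, AEMeasurable (Y j) P) {ρ : (Fin n → ℝ) → ℝ}
    (hρ : ∀ c : Fin n → ℝ,
      ‖∫ ω, Complex.exp ((∑ j, c j * Y j ω : ℝ) * Complex.I) ∂P‖ ≤ ρ c)
    {ε δ : ℝ} (hε : 0 < ε) (hδ : 0 < δ) (z : ℝ) :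
    ‖∫ ω, ∏ j, (heatKernel ε (Y j ω - z) - heatKernel δ (Y j ω - z)) ∂P‖ₑ ≤
      ∫⁻ c : Fin n → ℝ, ENNReal.ofReal (ρ c) * ∏ j, ‖symbolDiff ε δ (c j)‖ₑ := by
  let F : Ω → (Fin n → ℝ) → ℂ := fun ω c =>
    ∏ j, Complex.exp ((c j * (Y j ω - z) : ℝ) * Complex.I) * (symbolDiff ε δ (c j) : ℝ)
  have h1 : ∀ ω, ((∏ j, (heatKernel ε (Y j ω - z) - heatKernel δ (Y j ω - z)) : ℝ) : ℂ) =
      ((1 / (2 * Real.pi)) ^ n : ℝ) * ∫ c, F ω c := by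
    intro ω
    rw [Complex.ofReal_prod]
    simp_rw [ofReal_heatKernel_sub hε hδ]
    rw [Finset.prod_mul_distrib, Finset.prod_const, Finset.card_univ, Fintype.card_fin,
      Complex.ofReal_pow, ← integral_fintype_prod_volume_eq_prod (fun j (c : ℝ) =>
        Complex.exp ((c * (Y j ω - z) : ℝ) * Complex.I) * (symbolDiff ε δ c : ℝ))]
  have hFn : ∀ ω c, ‖F ω c‖ = ‖∏ j, symbolDiff ε δ (c j)‖ := by
    intro ω c
    simp only [F, norm_prod, norm_mul, Complex.norm_exp_ofReal_mul_I, one_mul, Complex.norm_real]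
  have hF : Integrable (Function.uncurry F) (P.prod volume) := by
    have hb : Integrable (fun c : Fin n → ℝ => ∏ j, symbolDiff ε δ (c j)) :=
      Integrable.fintype_prod fun _ => integrable_symbolDiff hε hδ
    refine (hb.comp_snd P).mono ?_ (ae_of_all _ fun q => (hFn q.1 q.2).le)
    refine AEMeasurable.aestronglyMeasurable ?_
    refine Finset.aemeasurable_fun_prod _ fun j _ => AEMeasurable.mul ?_ ?_
    · have hYj : AEMeasurable (fun q : Ω × (Fin n → ℝ) => Y j q.1) (P.prod volume) :=
        (hY j).comp_quasiMeasurePreserving Measure.quasiMeasurePreserving_fst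
      have hc : Measurable fun q : Ω × (Fin n → ℝ) => q.2 j := by fun_prop
      exact Complex.measurable_exp.comp_aemeasurable
        ((Complex.measurable_ofReal.comp_aemeasurable
          (hc.aemeasurable.mul (hYj.sub_const z))).mul_const _)
    · exact (Measurable.aemeasurable (by fun_prop))
  have hin : ∀ c : Fin n → ℝ, ‖∫ ω, F ω c ∂P‖ₑ ≤
      ENNReal.ofReal (ρ c) * ∏ j, ‖symbolDiff ε δ (c j)‖ₑ := by
    intro c
    have h2 : ∀ ω, F ω c = Complex.exp ((∑ j, c j * Y j ω : ℝ) * Complex.I) *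
        ∏ j, (Complex.exp ((-(c j * z) : ℝ) * Complex.I) * (symbolDiff ε δ (c j) : ℝ)) := by
      intro ω
      rw [Complex.ofReal_sum, Finset.sum_mul, Complex.exp_sum, ← Finset.prod_mul_distrib]
      refine Finset.prod_congr rfl fun j _ => ?_
      rw [← mul_assoc, ← Complex.exp_add]
      congr 2
      push_cast
      ring
    simp_rw [h2]
    rw [integral_mul_const, enorm_mul]
    refine mul_le_mul' ?_ (le_of_eq ?_)
    · rw [← ofReal_norm]
      exact ENNReal.ofReal_le_ofReal (hρ c)
    · rw [← ofReal_norm, norm_prod, ENNReal.ofReal_prod_of_nonneg fun _ _ => norm_nonneg _]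
      refine Finset.prod_congr rfl fun j _ => ?_
      rw [norm_mul, Complex.norm_exp_ofReal_mul_I, one_mul, Complex.norm_real, ofReal_norm]
  have h3 : ‖∫ ω, ∏ j, (heatKernel ε (Y j ω - z) - heatKernel δ (Y j ω - z)) ∂P‖ₑ =
      ‖(((1 / (2 * Real.pi)) ^ n : ℝ) : ℂ) * ∫ c, ∫ ω, F ω c ∂P‖ₑ := by
    rw [← integral_integral_swap hF, ← integral_const_mul]
    simp_rw [← h1]
    rw [integral_complex_ofReal, ← ofReal_norm, ← ofReal_norm, Complex.norm_real]
  rw [h3, enorm_mul]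
  have h4 : ‖(((1 / (2 * Real.pi)) ^ n : ℝ) : ℂ)‖ₑ ≤ 1 := by
    rw [← ofReal_norm, Complex.norm_real, Real.norm_of_nonneg (by positivity),
      ENNReal.ofReal_le_one]
    refine pow_le_one₀ (by positivity) ?_
    rw [div_le_one (by positivity)]
    linarith [Real.pi_gt_three]
  calc _ ≤ 1 * ∫⁻ c, ‖∫ ω, F ω c ∂P‖ₑ := mul_le_mul' h4 (enorm_integral_le_lintegral_enorm _)
    _ ≤ _ := by
      rw [one_mul]
      exact lintegral_mono hin

variable {y : ℝ → Ω → ℝ} {T₁ T₂ : ℝ}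

lemma integrable_heatKernel_comp
    (hy : AEMeasurable (fun q : ℝ × Ω => y q.1 q.2) ((volume.restrict (Set.Icc T₁ T₂)).prod P))
    (z : ℝ) {ε : ℝ} (hε : 0 < ε) :
    Integrable (fun q : ℝ × Ω => heatKernel ε (y q.1 q.2 - z))
      ((volume.restrict (Set.Icc T₁ T₂)).prod P) := by
  refine Integrable.of_bound (C := 1 / √(2 * Real.pi * ε)) ?_ (ae_of_all _ fun q => ?_)
  · exact (continuous_heatKernel ε).comp_aestronglyMeasurable
      (hy.sub_const z).aestronglyMeasurable
  · rw [Real.norm_of_nonneg (heatKernel_pos hε _).le]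
    exact heatKernel_le hε _

lemma memLp_localTimeApprox (hT : T₁ ≤ T₂)
    (hy : AEMeasurable (fun q : ℝ × Ω => y q.1 q.2) ((volume.restrict (Set.Icc T₁ T₂)).prod P))
    (z : ℝ) {ε : ℝ} (hε : 0 < ε) (p : ℝ≥0∞) :
    MemLp (localTimeApprox y T₁ T₂ z ε) p P := by
  rw [show localTimeApprox y T₁ T₂ z ε = fun ω => ∫ u in Set.Icc T₁ T₂, heatKernel ε (y u ω - z)
    from funext (localTimeApprox_eq hT z ε)]
  refine MemLp.of_bound (integrable_heatKernel_comp hy z hε).integral_prod_right.1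
    (1 / √(2 * Real.pi * ε) * (volume.restrict (Set.Icc T₁ T₂)).real Set.univ)
    (ae_of_all _ fun ω => ?_)
  refine norm_integral_le_of_norm_le_const (ae_of_all _ fun u => ?_)
  rw [Real.norm_of_nonneg (heatKernel_pos hε _).le]
  exact heatKernel_le hε _

/-- For even `n` the `n`-th absolute moment is the moment itself, so it expands into an `n`-fold
time integral with the expectation inside. Absolute values are taken only after the expectation,
which keeps its decay in the frequencies. -/
lemma eLpNorm_localTimeApprox_sub_pow_le (hT : T₁ ≤ T₂)
    (hy : AEMeasurable (fun q : ℝ × Ω => y q.1 q.2) ((volume.restrict (Set.Icc T₁ T₂)).prod P))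
    (hy' : ∀ u, AEMeasurable (y u) P) {n : ℕ} (hn : Even n) (hn0 : n ≠ 0)
    {ρ : (Fin n → ℝ) → (Fin n → ℝ) → ℝ}
    (hρ : ∀ u : Fin n → ℝ, (∀ j, u j ∈ Set.Icc T₁ T₂) → ∀ c : Fin n → ℝ,
      ‖∫ ω, Complex.exp ((∑ j, c j * y (u j) ω : ℝ) * Complex.I) ∂P‖ ≤ ρ u c)
    (z : ℝ) {ε δ : ℝ} (hε : 0 < ε) (hδ : 0 < δ) :
    eLpNorm (fun ω => localTimeApprox y T₁ T₂ z ε ω - localTimeApprox y T₁ T₂ z δ ω) n P ^ n ≤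
      ∫⁻ u in Set.univ.pi (fun _ : Fin n => Set.Icc T₁ T₂), ∫⁻ c : Fin n → ℝ,
        ENNReal.ofReal (ρ u c) * ∏ j, ‖symbolDiff ε δ (c j)‖ₑ := by
  set ν : Measure ℝ := volume.restrict (Set.Icc T₁ T₂) with hν
  set Δ : Ω → ℝ := fun ω => localTimeApprox y T₁ T₂ z ε ω - localTimeApprox y T₁ T₂ z δ ω with hΔ
  have hΔm : ∀ p, MemLp Δ p P := fun p =>
    (memLp_localTimeApprox hT hy z hε p).sub (memLp_localTimeApprox hT hy z hδ p)
  let D : ℝ → ℝ := fun x => heatKernel ε (x - z) - heatKernel δ (x - z)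
  have hDc : Continuous D := by fun_prop
  have hDb : ∀ x, ‖D x‖ ≤ 1 / √(2 * Real.pi * ε) + 1 / √(2 * Real.pi * δ) := fun x => by
    refine (norm_sub_le _ _).trans (add_le_add ?_ ?_)
    · rw [Real.norm_of_nonneg (heatKernel_pos hε _).le]
      exact heatKernel_le hε _
    · rw [Real.norm_of_nonneg (heatKernel_pos hδ _).le]
      exact heatKernel_le hδ _
  have hpow : ∀ᵐ ω ∂P, Δ ω ^ n =
      ∫ u : Fin n → ℝ, ∏ j, D (y (u j) ω) ∂(Measure.pi fun _ => ν) := by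
    filter_upwards [(integrable_heatKernel_comp hy z hε).prod_left_ae,
      (integrable_heatKernel_comp hy z hδ).prod_left_ae] with ω h1 h2
    rw [integral_fintype_prod_eq_prod (fun _ u => D (y u ω)), Finset.prod_const, Finset.card_univ,
      Fintype.card_fin, hΔ]
    dsimp only
    rw [localTimeApprox_eq hT, localTimeApprox_eq hT, ← integral_sub h1 h2]
  have hint : Integrable (Function.uncurry fun (ω : Ω) (u : Fin n → ℝ) => ∏ j, D (y (u j) ω))
      (P.prod (Measure.pi fun _ => ν)) := by
    refine Integrable.of_bound
      (C := ∏ _j : Fin n, (1 / √(2 * Real.pi * ε) + 1 / √(2 * Real.pi * δ))) ?_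
      (ae_of_all _ fun q => ?_)
    · refine AEMeasurable.aestronglyMeasurable (Finset.aemeasurable_fun_prod _ fun j _ => ?_)
      refine hDc.measurable.comp_aemeasurable ?_
      -- `y` is only almost everywhere jointly measurable, so composing with `(ω, u) ↦ (u_j, ω)`
      -- requires that null sets pull back to null sets.
      have hq : Measure.QuasiMeasurePreserving (fun q : Ω × (Fin n → ℝ) => (q.2 j, q.1))
          (P.prod (Measure.pi fun _ => ν)) (ν.prod P) :=
        (MeasureTheory.QuasiMeasurePreserving.prodMap
          (Measure.quasiMeasurePreserving_eval (fun _ : Fin n => ν) j)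
          (Measure.QuasiMeasurePreserving.id P)).comp
          Measure.measurePreserving_swap.quasiMeasurePreserving
      exact hy.comp_quasiMeasurePreserving hq
    · simp only [Function.uncurry]
      rw [norm_prod]
      exact Finset.prod_le_prod (fun _ _ => norm_nonneg _) fun j _ => hDb _
  have hmom : eLpNorm Δ n P ^ n = ‖∫ ω, Δ ω ^ n ∂P‖ₑ := by
    have h1 : ∀ ω, Δ ω ^ n = ‖Δ ω‖ ^ n := fun ω => by
      rw [Real.norm_eq_abs, hn.pow_abs]
    rw [← ofReal_norm, Real.norm_of_nonneg (integral_nonneg fun ω => hn.pow_nonneg _)]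
    simp_rw [h1]
    rw [ofReal_integral_eq_lintegral_ofReal ((hΔm n).integrable_norm_pow hn0)
      (ae_of_all _ fun _ => by positivity)]
    simp_rw [ENNReal.ofReal_pow (norm_nonneg _), ofReal_norm]
    have := eLpNorm_nnreal_pow_eq_lintegral (f := Δ) (μ := P) (p := n) (by exact_mod_cast hn0)
    simpa using this
  have hpi : (Measure.pi fun _ : Fin n => ν) =
      volume.restrict (Set.univ.pi fun _ : Fin n => Set.Icc T₁ T₂) := by
    rw [volume_pi, Measure.restrict_pi_pi]
  rw [hmom, integral_congr_ae hpow, integral_integral_swap hint, hpi]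
  refine (enorm_integral_le_lintegral_enorm _).trans ?_
  refine setLIntegral_mono' (MeasurableSet.univ_pi fun _ => measurableSet_Icc) fun u hu => ?_
  exact enorm_integral_prod_heatKernel_sub_le (fun j => hy' (u j))
    (hρ u fun j => hu j trivial) hε hδ z

/-- Dominated convergence: each symbol is at most `1` in modulus and tends to `0` pointwise, and the
Brownian exponential is integrable. For `n = 0` the empty product would not vanish. -/
lemma tendsto_lintegral_prod_symbolDiff {κ : ℝ} (hκ : 0 < κ) (a b : ℝ) {n : ℕ} (hn : n ≠ 0) :
    Tendsto (fun q : ℝ × ℝ =>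
      ∫⁻ u in Set.univ.pi (fun _ : Fin n => Set.Icc a b), ∫⁻ c : Fin n → ℝ,
        ENNReal.ofReal (Real.exp (-κ * minForm a u c)) * ∏ j, ‖symbolDiff q.1 q.2 (c j)‖ₑ)
      (𝓝[>] 0 ×ˢ 𝓝[>] 0) (𝓝 0) := by
  set ν : Measure (Fin n → ℝ) := volume.restrict (Set.univ.pi fun _ : Fin n => Set.Icc a b)
  have hEm : Measurable fun r : (Fin n → ℝ) × (Fin n → ℝ) =>
      ENNReal.ofReal (Real.exp (-κ * minForm a r.1 r.2)) :=
    measurable_ofReal_exp_minForm κ a continuous_fst continuous_snd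
  have hm : ∀ q : ℝ × ℝ, Measurable fun r : (Fin n → ℝ) × (Fin n → ℝ) =>
      ENNReal.ofReal (Real.exp (-κ * minForm a r.1 r.2)) *
        ∏ j, ‖symbolDiff q.1 q.2 (r.2 j)‖ₑ := fun q => by
    refine hEm.mul (Finset.measurable_fun_prod _ fun j _ => ?_)
    exact Measurable.enorm (Continuous.measurable (by fun_prop))
  have h1 : ∀ q : ℝ × ℝ, ∫⁻ u, ∫⁻ c : Fin n → ℝ,
        ENNReal.ofReal (Real.exp (-κ * minForm a u c)) * ∏ j, ‖symbolDiff q.1 q.2 (c j)‖ₑ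
          ∂volume ∂ν =
      ∫⁻ r, ENNReal.ofReal (Real.exp (-κ * minForm a r.1 r.2)) *
        ∏ j, ‖symbolDiff q.1 q.2 (r.2 j)‖ₑ ∂(ν.prod volume) := fun q => by
    rw [lintegral_prod _ (hm q).aemeasurable]
  refine Tendsto.congr (fun q => (h1 q).symm) ?_
  rw [show (0 : ℝ≥0∞) = ∫⁻ _r : (Fin n → ℝ) × (Fin n → ℝ), 0 ∂(ν.prod volume) by simp]
  refine tendsto_lintegral_filter_of_dominated_convergence
    (fun r => ENNReal.ofReal (Real.exp (-κ * minForm a r.1 r.2)))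
    (Eventually.of_forall hm) ?_ ?_ (ae_of_all _ fun r => ?_)
  · filter_upwards [prod_mem_prod self_mem_nhdsWithin self_mem_nhdsWithin] with q hq
    refine ae_of_all _ fun r => mul_le_of_le_one_right' ?_
    refine Finset.prod_le_one' fun j _ => ?_
    rw [← ofReal_norm, ENNReal.ofReal_le_one]
    exact norm_symbolDiff_le_one hq.1 hq.2 _
  · obtain ⟨C, hC, h⟩ := exists_lintegral_exp_neg_minForm_le hκ a b n
    rw [lintegral_prod _ hEm.aemeasurable]
    exact ((h a le_rfl).trans_lt hC).ne
  · have h2 : ∀ x : ℝ, Tendsto (fun q : ℝ × ℝ => ‖symbolDiff q.1 q.2 x‖ₑ)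
        (𝓝[>] 0 ×ˢ 𝓝[>] 0) (𝓝 0) := fun x => by
      have hc : Continuous fun q : ℝ × ℝ => ‖symbolDiff q.1 q.2 x‖ₑ := by
        unfold symbolDiff
        fun_prop
      have := hc.tendsto (0, 0)
      rw [nhds_prod_eq] at this
      have h3 := this.mono_left (prod_mono (nhdsWithin_le_nhds (s := Set.Ioi 0))
        (nhdsWithin_le_nhds (s := Set.Ioi 0)))
      simpa [symbolDiff] using h3
    have h3 : Tendsto (fun q : ℝ × ℝ => ∏ j, ‖symbolDiff q.1 q.2 (r.2 j)‖ₑ)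
        (𝓝[>] 0 ×ˢ 𝓝[>] 0) (𝓝 0) := by
      have h4 := ENNReal.tendsto_finsetProd_of_ne_top Finset.univ
        (fun (j : Fin n) _ => h2 (r.2 j)) (by simp)
      simpa [hn] using h4
    simpa using ENNReal.Tendsto.const_mul h3 (Or.inr ENNReal.ofReal_ne_top)

end Moments

/-! ### A common limit in all `L_p`. -/

section Completeness

variable {Ω : Type*} [MeasurableSpace Ω] {P : Measure Ω}

/-- A family that is Cauchy in every `L_p` as the parameter tends to `0+` has a common limit. -/
lemma exists_tendsto_eLpNorm_sub {L : ℝ → Ω → ℝ}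
    (hL : ∀ ε, 0 < ε → ∀ p : ℝ≥0∞, MemLp (L ε) p P)
    (hc : ∀ p : ℕ, 1 ≤ p → Tendsto (fun q : ℝ × ℝ => eLpNorm (fun ω => L q.1 ω - L q.2 ω) p P)
      (𝓝[>] 0 ×ˢ 𝓝[>] 0) (𝓝 0)) :
    ∃ l : Ω → ℝ, ∀ p : ℕ, 1 ≤ p → MemLp l p P ∧
      Tendsto (fun ε => eLpNorm (fun ω => L ε ω - l ω) p P) (𝓝[>] 0) (𝓝 0) := by
  let e : ℕ → ℝ := fun k => 1 / ((k : ℝ) + 1)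
  have he0 : ∀ k, 0 < e k := fun k => Nat.one_div_pos_of_nat
  have he : Tendsto e atTop (𝓝[>] 0) :=
    tendsto_nhdsWithin_iff.2 ⟨tendsto_one_div_add_atTop_nhds_zero_nat, Eventually.of_forall he0⟩
  have hlim : ∀ p : ℕ, 1 ≤ p → ∃ l : Ω → ℝ, MemLp l p P ∧
      Tendsto (fun k => eLpNorm (fun ω => L (e k) ω - l ω) p P) atTop (𝓝 0) := by
    intro p hp
    have : Fact ((1 : ℝ≥0∞) ≤ p) := ⟨by exact_mod_cast hp⟩
    have hcs : CauchySeq fun k => (hL (e k) (he0 k) p).toLp (L (e k)) := by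
      rw [Lp.cauchySeq_Lp_iff_cauchySeq_eLpNorm]
      have h1 := (hc p hp).comp (he.prodMap he)
      rw [prod_atTop_atTop_eq] at h1
      refine h1.congr fun k => ?_
      refine eLpNorm_congr_ae ?_
      filter_upwards [(hL (e k.1) (he0 k.1) p).coeFn_toLp,
        (hL (e k.2) (he0 k.2) p).coeFn_toLp] with ω h1 h2
      simp [h1, h2]
    obtain ⟨l, hl⟩ := cauchySeq_tendsto_of_complete hcs
    refine ⟨l, Lp.memLp l, ?_⟩
    have h2 := (Lp.tendsto_Lp_iff_tendsto_eLpNorm' _ l).1 hl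
    refine h2.congr fun k => eLpNorm_congr_ae ?_
    filter_upwards [(hL (e k) (he0 k) p).coeFn_toLp] with ω h1
    simp [h1]
  choose! l hl hlt using hlim
  -- Limits in different `L_p` along the same sequence agree almost surely, as limits in measure;
  -- hence `l 1` serves every `p`.
  have hae : ∀ p, 1 ≤ p → l p =ᵐ[P] l 1 := by
    intro p hp
    have hmeas : ∀ p, 1 ≤ p → TendstoInMeasure P (fun k => L (e k)) atTop (l p) := fun p hp =>
      tendstoInMeasure_of_tendsto_eLpNorm (p := p) (by positivity)
        (fun k => (hL (e k) (he0 k) p).1) (hl p hp).1 (hlt p hp)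
    exact tendstoInMeasure_ae_unique (hmeas p hp) (hmeas 1 le_rfl)
  refine ⟨l 1, fun p hp => ⟨(hl p hp).ae_eq (hae p hp), ?_⟩⟩
  rw [ENNReal.tendsto_nhds_zero]
  intro η hη
  have h1 : ∀ᶠ q : ℝ × ℝ in 𝓝[>] 0 ×ˢ 𝓝[>] 0,
      eLpNorm (fun ω => L q.1 ω - L q.2 ω) p P ≤ η / 2 :=
    ENNReal.tendsto_nhds_zero.1 (hc p hp) _ (ENNReal.half_pos hη.ne')
  -- For fixed small `ε`, the Cauchy bound holds for all small enough second parameters, in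
  -- particular for some `e k` already close to the limit.
  filter_upwards [h1.curry, self_mem_nhdsWithin] with ε h2 hε
  have h3 := ENNReal.tendsto_nhds_zero.1 (hlt p hp) _ (ENNReal.half_pos hη.ne')
  obtain ⟨k, h4, h5⟩ := ((he.eventually h2).and h3).exists
  calc eLpNorm (fun ω => L ε ω - l 1 ω) p P
      = eLpNorm ((fun ω => L ε ω - L (e k) ω) + fun ω => L (e k) ω - l p ω) p P := by
        refine eLpNorm_congr_ae ?_
        filter_upwards [hae p hp] with ω hω
        simp [hω]
    _ ≤ _ + _ := eLpNorm_add_le ((hL ε hε p).sub (hL (e k) (he0 k) p)).1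
        ((hL (e k) (he0 k) p).sub (hl p hp)).1 (by exact_mod_cast hp)
    _ ≤ η / 2 + η / 2 := add_le_add h4 h5
    _ = η := ENNReal.add_halves η

end Completeness

end HeatLocalTime

end

/-! ### Existence of the local time. -/

theorem theorem2p2 {Ω : Type*} [MeasurableSpace Ω] (P : Measure Ω) [IsProbabilityMeasure P]
    (W : Set (ℝ × ℝ) → Ω → ℝ)
    (hW : HeatLocalTime.IsWhiteNoise HeatLocalTime.spaceTimeMeasure P W)
    (x : ℝ → Ω → ℝ) (hx : HeatLocalTime.IsHeatSolutionAt P W 1 x)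
    (U₁ U₂ : ℝ) (hU : U₁ < U₂)
    (hmeas : AEMeasurable (fun q : ℝ × Ω => x q.1 q.2)
      ((volume.restrict (Set.Icc U₁ U₂)).prod P))
    (z : ℝ) :
    ∃ l : Ω → ℝ,
      HeatLocalTime.IsLocalTime P (fun u ω => x u ω - x U₁ ω) U₁ U₂ z l := by
  open HeatLocalTime in
  have hxm : ∀ u, AEMeasurable (x u) P := fun u => (hx u).2.1.1.aemeasurable
  have hy : AEMeasurable (fun q : ℝ × Ω => x q.1 q.2 - x U₁ q.2)
      ((volume.restrict (Set.Icc U₁ U₂)).prod P) :=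
    hmeas.sub ((hxm U₁).comp_quasiMeasurePreserving Measure.quasiMeasurePreserving_snd)
  have hm : ∀ u, MemLp (heatIntegrand 1 u) 2 spaceTimeMeasure := fun u => (hx u).1
  -- The comparison constant, halved by the `1 / 2` in the Gaussian characteristic function
  -- `exp(-variance / 2)`.
  set κ : ℝ := (1 - 2 * heatCDF (U₂ - U₁)) / 2 with hκ
  have hκ0 : 0 < κ := by
    have := heatCDF_lt (U₂ - U₁)
    rw [hκ]
    linarith
  have hchar : ∀ n, ∀ u : Fin n → ℝ, (∀ j, u j ∈ Set.Icc U₁ U₂) → ∀ c : Fin n → ℝ,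
      ‖∫ ω, Complex.exp ((∑ j, c j * (x (u j) ω - x U₁ ω) : ℝ) * Complex.I) ∂P‖ ≤
        Real.exp (-κ * minForm U₁ u c) := by
    intro n u hu c
    -- The index `none` carries `x U₁` with coefficient `-∑ j, c j`, turning values into increments.
    have h1 := hW.integral_cexp_sum (ι := Option (Fin n))
      (f := fun i => i.elim (heatIntegrand 1 U₁) fun j => heatIntegrand 1 (u j))
      (X := fun i => i.elim (x U₁) fun j => x (u j))
      (fun i => by cases i <;> exact hx _) (fun i => i.elim (-∑ j, c j) c)
    simp only [Fintype.sum_option, Option.elim_none, Option.elim_some] at h1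
    have h2 : ∀ (s : ℝ) (t : Fin n → ℝ), (-∑ j, c j) * s + ∑ j, c j * t j =
        ∑ j, c j * (t j - s) := fun s t => by
      simp_rw [mul_sub]
      rw [Finset.sum_sub_distrib, ← Finset.sum_mul]
      ring
    simp_rw [h2] at h1
    rw [h1, Complex.norm_exp]
    refine Real.exp_le_exp.2 ?_
    have h3 := le_integral_sq_sum_heatIntegrand hU.le hm hu c
    rw [← Complex.ofReal_neg, ← Complex.ofReal_ofNat, ← Complex.ofReal_div, Complex.ofReal_re, hκ]
    linarith
  have hmem : ∀ ε, 0 < ε → ∀ p : ℝ≥0∞,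
      MemLp (localTimeApprox (fun u ω => x u ω - x U₁ ω) U₁ U₂ z ε) p P := fun ε hε p =>
    memLp_localTimeApprox hU.le hy z hε p
  obtain ⟨l, hl⟩ := exists_tendsto_eLpNorm_sub hmem fun p hp => by
    -- The moment estimate needs an even exponent, so `2 * p` is used; on a probability space the
    -- `L_p` norm is at most the `L_{2p}` norm.
    have hp0 : 2 * p ≠ 0 := by omega
    have h1 := tendsto_lintegral_prod_symbolDiff hκ0 U₁ U₂ hp0
    have h2 : Tendsto (fun q : ℝ × ℝ => eLpNorm (fun ω =>
        localTimeApprox (fun u ω => x u ω - x U₁ ω) U₁ U₂ z q.1 ω -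
        localTimeApprox (fun u ω => x u ω - x U₁ ω) U₁ U₂ z q.2 ω) (2 * p : ℕ) P ^ (2 * p))
        (𝓝[>] 0 ×ˢ 𝓝[>] 0) (𝓝 0) := by
      refine tendsto_of_tendsto_of_tendsto_of_le_of_le' tendsto_const_nhds h1
        (Eventually.of_forall fun _ => zero_le) ?_
      filter_upwards [prod_mem_prod self_mem_nhdsWithin self_mem_nhdsWithin] with q hq
      exact eLpNorm_localTimeApprox_sub_pow_le hU.le hy (fun u => (hxm u).sub (hxm U₁))
        (even_two_mul p) hp0 (hchar _) z hq.1 hq.2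
    have h3 : Tendsto (fun q : ℝ × ℝ => eLpNorm (fun ω =>
        localTimeApprox (fun u ω => x u ω - x U₁ ω) U₁ U₂ z q.1 ω -
        localTimeApprox (fun u ω => x u ω - x U₁ ω) U₁ U₂ z q.2 ω) (2 * p : ℕ) P)
        (𝓝[>] 0 ×ˢ 𝓝[>] 0) (𝓝 0) := by
      rw [ENNReal.tendsto_nhds_zero] at h2 ⊢
      intro η hη
      filter_upwards [h2 (η ^ (2 * p)) (by positivity)] with q hq
      exact (ENNReal.pow_le_pow_left_iff hp0).1 hq
    refine tendsto_of_tendsto_of_tendsto_of_le_of_le' tendsto_const_nhds h3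
      (Eventually.of_forall fun _ => zero_le) ?_
    filter_upwards [prod_mem_prod self_mem_nhdsWithin self_mem_nhdsWithin] with q hq
    refine eLpNorm_le_eLpNorm_of_exponent_le ?_ ((hmem _ hq.1 p).sub (hmem _ hq.2 p)).1
    exact_mod_cast Nat.le_mul_of_pos_left p two_pos
  exact ⟨l, fun p hp => ⟨fun ε hε => hmem ε hε p, hl p hp⟩⟩
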